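/- Let $k\ge 1$ and $d\ge 1$ be integers and $0<\beta<\min(2,k)$. Let $F=(F^1,\dots,F^d)$ be a centered Gaussian process indexed by test functions $\phi\in C_c^\infty(\mathbb R^{1+k})$, with covariance $$\mathrm E[F^i(\phi)F^j(\psi)]=\delta_{ij}\int_{\mathbb R_+}dr\int_{\mathbb R^k}dy\int_{\mathbb R^k}dz\,\phi(r,y)\,\|y-z\|^{-\beta}\,\psi(r,z),$$ and let $M=(M^1,\dots,M^d)$ be the martingale measure obtained by extending $F$ in $L^2$, $M^i_t(A)=F^i(1_{[0,t]\times A})$ for $t\ge 0$ and $A\subset\mathbb R^k$ bounded Borel. Let $v=(v_1,\dots,v_d)$ be the mild solution of the linear system $\frac{\partial}{\partial t}v_i=\frac12\Delta_x v_i+\dot F^i$, $v_i(0,\cdot)=0$, on $\mathbb R_+\times\mathbb R^k$; that is, $v$ is a jointly measurable process, adapted to the ($P$-augmented) natural filtration of $M$, such that for all $t\ge0$, $x\in\mathbb R^k$ and $i\in\{1,\dots,d\}$, almost surely, $$v_i(t,x)=\int_0^t\int_{\mathbb R^k}S(t-s,x-y)\,M^i(ds,dy),\qquad S(t,x)=(2\pi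 t)^{-k/2}e^{-\|x\|^2/(2t)},$$ the stochastic integral being understood in the sense of Walsh. Then for all $t_0>0$, $p>1$ and every compact set $K\subset\mathbb R^k$ there is a constant $c_1>0$, depending only on $k,\beta,p,t_0,K$, such that for all $T>t_0$, all $t_0\le s\le t\le T$, all $x,y\in K$ and all $i\in\{1,\dots,d\}$, $$\mathrm E\big[|v_i(t,x)-v_i(s,y)|^p\big]\ \ge\ c_1\Big(|t-s|^{\frac{2-\beta}{4}p}+\|x-y\|^{\frac{2-\beta}{2}p}\Big).$$ -/

import Mathlib

open MeasureTheory ProbabilityTheory Filter Topology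
open scoped ENNReal

namespace StochHeat

noncomputable section

/-- `ℝ^n` with its Euclidean norm. -/
abbrev Eucl (n : ℕ) : Type := EuclideanSpace ℝ (Fin n)

/-- The test functions `𝒟(ℝ^{1+k})` (smooth, compactly supported) in the variables `(r, y)`. -/
abbrev SpaceTimeTest (k : ℕ) : Type :=
  TestFunction (⊤ : TopologicalSpace.Opens (ℝ × Eucl k)) ℝ ⊤

/-- The heat kernel `S(t,x) = (2πt)^{-k/2} exp(-‖x‖²/(2t))`, used for `t > 0`. -/
def heatKernel {k : ℕ} (t : ℝ) (x : Eucl k) : ℝ :=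
  (2 * Real.pi * t) ^ (-(k : ℝ) / 2) * Real.exp (-‖x‖ ^ 2 / (2 * t))

variable {Ω : Type*} [MeasurableSpace Ω]

/-- `F = (F¹, …, F^d)` is a centered Gaussian process indexed by test functions, white in time and
with spatial covariance given by the Riesz kernel `‖y - z‖^{-β}`, with independent components. -/
structure IsRieszNoise {k d : ℕ} (P : Measure Ω) (β : ℝ)
    (F : Fin d → SpaceTimeTest k → Ω → ℝ) : Prop where
  gaussian : IsGaussianProcess (fun q : Fin d × SpaceTimeTest k => F q.1 q.2) P
  mean_zero : ∀ i φ, ∫ ω, F i φ ω ∂P = 0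
  covariance : ∀ i j φ ψ, ∫ ω, F i φ ω * F j ψ ω ∂P =
    (if i = j then 1 else 0) *
      ∫ r in Set.Ioi (0 : ℝ), ∫ y, ∫ z, φ (r, y) * ‖y - z‖ ^ (-β) * ψ (r, z)

/-- `∫_I dr ∫ dy ∫ dz |g(r,y)| ‖y - z‖^{-β} |g(r,z)|`, with values in `[0, ∞]`. -/
def rieszEnergy {k : ℕ} (β : ℝ) (I : Set ℝ) (g : ℝ → Eucl k → ℝ) : ℝ≥0∞ :=
  ∫⁻ r in I, ∫⁻ y, ∫⁻ z, ENNReal.ofReal (|g r y| * ‖y - z‖ ^ (-β) * |g r z|)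

/-- `M` is the martingale measure obtained by extending `F`: for each bounded Borel set `A` and each
`t ≥ 0`, the random variable `M^i_t(A)` is the value at `1_{[0,t] × A}` of the `L²`-extension
of `F^i`. -/
structure IsMartingaleMeasureOf {k d : ℕ} (P : Measure Ω) (β : ℝ)
    (F : Fin d → SpaceTimeTest k → Ω → ℝ) (M : Fin d → ℝ → Set (Eucl k) → Ω → ℝ) : Prop where
  measurable : ∀ i t A, 0 ≤ t → MeasurableSet A → Bornology.IsBounded A → Measurable (M i t A)
  extension : ∀ i t A, 0 ≤ t → MeasurableSet A → Bornology.IsBounded A →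
    ∃ φ : ℕ → SpaceTimeTest k,
      Tendsto (fun n => rieszEnergy β (Set.Ioi 0) (fun r y =>
        φ n (r, y) - (Set.Icc 0 t ×ˢ A).indicator (fun _ => (1 : ℝ)) (r, y))) atTop (𝓝 0) ∧
      Tendsto (fun n => eLpNorm (fun ω => F i (φ n) ω - M i t A ω) 2 P) atTop (𝓝 0)

/-- The natural filtration of `M` (all components), augmented by the `P`-null events. -/
abbrev naturalFiltration {k d : ℕ} (P : Measure Ω) (M : Fin d → ℝ → Set (Eucl k) → Ω → ℝ) (t : ℝ) :
    MeasurableSpace Ω :=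
  MeasurableSpace.generateFrom
    ({B | ∃ i s A, 0 ≤ s ∧ s ≤ t ∧ MeasurableSet A ∧ Bornology.IsBounded A ∧
        ∃ U : Set ℝ, MeasurableSet U ∧ B = M i s A ⁻¹' U} ∪
      {N | MeasurableSet N ∧ P N = 0})

/-- An elementary process `(s, y, ω) ↦ X(ω) 1_{(a,b]}(s) 1_A(y)`, with `X` bounded and
`ℱ_a`-measurable and `A` bounded Borel. -/
structure ElementaryProcess (k : ℕ) (ℱ : ℝ → MeasurableSpace Ω) where
  a : ℝ
  b : ℝ
  A : Set (Eucl k)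
  X : Ω → ℝ
  nonneg : 0 ≤ a
  lt : a < b
  measurableSet : MeasurableSet A
  isBounded : Bornology.IsBounded A
  measurable : Measurable[ℱ a] X
  bounded : ∃ C : ℝ, ∀ ω, |X ω| ≤ C

/-- The function `(s, y, ω) ↦ X(ω) 1_{(a,b]}(s) 1_A(y)`. -/
def ElementaryProcess.eval {k : ℕ} {ℱ : ℝ → MeasurableSpace Ω} (e : ElementaryProcess k ℱ)
    (s : ℝ) (y : Eucl k) (ω : Ω) : ℝ :=
  e.X ω * (Set.Ioc e.a e.b ×ˢ e.A).indicator (fun _ => (1 : ℝ)) (s, y)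

/-- `X (m_{t ∧ b}(A) - m_{t ∧ a}(A))`, the integral over `[0,t] × ℝ^k` of an elementary process. -/
def ElementaryProcess.integral {k : ℕ} {ℱ : ℝ → MeasurableSpace Ω} (e : ElementaryProcess k ℱ)
    (m : ℝ → Set (Eucl k) → Ω → ℝ) (t : ℝ) (ω : Ω) : ℝ :=
  e.X ω * (m (min t e.b) e.A ω - m (min t e.a) e.A ω)

/-- A simple process is a finite sum of elementary processes. -/
abbrev SimpleProcess (k : ℕ) (ℱ : ℝ → MeasurableSpace Ω) := List (ElementaryProcess k ℱ)

/-- The value at `(s, y, ω)` of a simple process. -/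
def SimpleProcess.eval {k : ℕ} {ℱ : ℝ → MeasurableSpace Ω} (f : SimpleProcess k ℱ)
    (s : ℝ) (y : Eucl k) (ω : Ω) : ℝ :=
  (f.map fun e => e.eval s y ω).sum

/-- The integral over `[0,t] × ℝ^k` of a simple process. -/
def SimpleProcess.integral {k : ℕ} {ℱ : ℝ → MeasurableSpace Ω} (f : SimpleProcess k ℱ)
    (m : ℝ → Set (Eucl k) → Ω → ℝ) (t : ℝ) (ω : Ω) : ℝ :=
  (f.map fun e => e.integral m t ω).sum

/-- `Y = ∫_0^t ∫_{ℝ^k} g(s,y) m(ds,dy)` in the sense of Walsh: `Y` is the `L²(P)`-limit of the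
integrals of simple processes that converge to `g` in the norm given by
`‖g‖² = E ∫_0^t ds ∫ dy ∫ dz |g(s,y)| ‖y - z‖^{-β} |g(s,z)|`, i.e. by the dominating measure of
`m`. -/
def IsWalshIntegral {k : ℕ} (P : Measure Ω) (β : ℝ) (ℱ : ℝ → MeasurableSpace Ω)
    (m : ℝ → Set (Eucl k) → Ω → ℝ) (t : ℝ) (g : ℝ → Eucl k → Ω → ℝ) (Y : Ω → ℝ) : Prop :=
  MemLp Y 2 P ∧
  ∃ f : ℕ → SimpleProcess k ℱ,
    Tendsto (fun n => ∫⁻ ω, rieszEnergy β (Set.Ioc 0 t)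
      (fun s y => g s y ω - (f n).eval s y ω) ∂P) atTop (𝓝 0) ∧
    Tendsto (fun n => eLpNorm (fun ω => (f n).integral m t ω - Y ω) 2 P) atTop (𝓝 0)

/-- `u` is a mild solution, with zero initial condition, of the system
`∂_t u_i = ½ Δ u_i + ∑_j σ_{ij}(u) Ḟ^j + b_i(u)` on `ℝ_+ × ℝ^k`, where `M` is the martingale measure
of the noise. Only the values `u t x` with `t ≥ 0` matter. -/
structure IsMildSolution {k d : ℕ} (P : Measure Ω) (β : ℝ)
    (M : Fin d → ℝ → Set (Eucl k) → Ω → ℝ)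
    (σ : Eucl d → Matrix (Fin d) (Fin d) ℝ) (b : Eucl d → Eucl d)
    (u : ℝ → Eucl k → Ω → Eucl d) : Prop where
  jointly_measurable :
    Measurable (fun q : Set.Ici (0 : ℝ) × Eucl k × Ω => u q.1 q.2.1 q.2.2)
  adapted : ∀ t x, 0 ≤ t → Measurable[naturalFiltration P M t] (u t x)
  mild : ∀ t x, 0 ≤ t → ∀ i, ∃ Y : Fin d → Ω → ℝ,
    (∀ j, IsWalshIntegral P β (naturalFiltration P M) (M j) t
      (fun s y ω => heatKernel (t - s) (x - y) * σ (u s y ω) i j) (Y j)) ∧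
    (∀ᵐ ω ∂P, Integrable (fun q : ℝ × Eucl k => heatKernel (t - q.1) (x - q.2) * b (u q.1 q.2 ω) i)
      ((volume.restrict (Set.Ioc 0 t)).prod volume)) ∧
    (∀ᵐ ω ∂P, u t x ω i = ∑ j, Y j ω +
      ∫ s in Set.Ioc 0 t, ∫ y, heatKernel (t - s) (x - y) * b (u s y ω) i)

end

end StochHeat

/-! The lower bound comes from duality, without computing the variance of the increment. Write `V =
v_i(t,x) - v_i(s,y)` and test it against the noise in a parabolic box, `G = M^i_b(B) - M^i_a(B)`
with `B` the ball of centre `x` and radius `ρ` and `b - a = ρ²`. Hölder's inequality gives `E[VG] ≤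
‖V‖_p ‖G‖_q`. Since `G` is a centered Gaussian variable of variance at most a constant times `ρ^{2 +
2k - β}`, its `L^q` norm is at most a constant times `ρ^{1 + k - β/2}`. If `E[VG] ≥ c ρ^{2 + k -
β}`, then `‖V‖_p ≥ c' ρ^{(2-β)/2}` (`IsMildSolution.le_moment_of_le_pairing`).

Time increments: take the box over `(s,t]` with `ρ = √(t-s)`. The value at time `s` does not see it,
and the heat kernel from `(t,x)` charges it on its own scale (`le_rieszForm_heatShift`). Space
increments: take `ρ = η‖x-y‖` and the box over `(s-ρ², s]`. If `t - s ≥ ρ²`, the time bound already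
suffices. Otherwise `(t,x)` still charges the box, whereas `(s,y)` is far away at parabolic scale
and contributes a small fraction when `η` is small (`rieszForm_heatShift_le`). The bound `s ≥ t₀`
and the compactness of `K` keep the box in positive time.

The probabilistic work is to identify `E[VG]` with the Riesz form of the heat kernel and the box,
and to show `V ∈ L^p`, without which Hölder's inequality cannot be applied. Both follow by
approximation with simple processes. The needed inputs are the Cauchy–Schwarz inequality for the
Riesz energy (`rieszMutual_le`), the independence of increments from the past (`indep_increments`)
and the resulting Walsh isometry. -/

namespace StochHeat

noncomputable section

/-! ### `L²` limits of Gaussian variables and processes. -/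

section GaussianLimits

variable {Ω : Type*} [MeasurableSpace Ω] {P : Measure Ω}

theorem tendsto_integral_mul_of_tendsto_eLpNorm {X Y : ℕ → Ω → ℝ} {X' Y' : Ω → ℝ}
    (hX : ∀ n, MemLp (X n) 2 P) (hY : ∀ n, MemLp (Y n) 2 P) (hX' : MemLp X' 2 P)
    (hY' : MemLp Y' 2 P)
    (hXX : Tendsto (fun n => eLpNorm (fun ω => X n ω - X' ω) 2 P) atTop (𝓝 0))
    (hYY : Tendsto (fun n => eLpNorm (fun ω => Y n ω - Y' ω) 2 P) atTop (𝓝 0)) :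
    Tendsto (fun n => ∫ ω, X n ω * Y n ω ∂P) atTop (𝓝 (∫ ω, X' ω * Y' ω ∂P)) := by
  have h1 := (Lp.tendsto_Lp_iff_tendsto_eLpNorm'' X hX X' hX').2 hXX
  have h2 := (Lp.tendsto_Lp_iff_tendsto_eLpNorm'' Y hY Y' hY').2 hYY
  have h3 := h1.inner h2 (𝕜 := ℝ)
  have key : ∀ {U V : Ω → ℝ} (hU : MemLp U 2 P) (hV : MemLp V 2 P),
      inner ℝ (hU.toLp U) (hV.toLp V) = ∫ ω, U ω * V ω ∂P := by
    intro U V hU hV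
    rw [L2.inner_def]
    refine integral_congr_ae ?_
    filter_upwards [hU.coeFn_toLp, hV.coeFn_toLp] with ω h1 h2
    rw [h1, h2]
    simp [mul_comm]
  simpa only [key] using h3

theorem memLp_two_of_eLpNorm_sub_lt_top {X Y : Ω → ℝ} (hX : MemLp X 2 P)
    (hY : AEStronglyMeasurable Y P) (h : eLpNorm (fun ω => X ω - Y ω) 2 P < ∞) : MemLp Y 2 P := by
  have : MemLp (fun ω => X ω - Y ω) 2 P := ⟨hX.1.sub hY, h⟩
  have h2 := hX.sub this
  refine h2.ae_eq (Eventually.of_forall fun ω => ?_)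
  simp

theorem memLp_two_of_tendsto {X : ℕ → Ω → ℝ} {Y : Ω → ℝ} (hX : ∀ n, MemLp (X n) 2 P)
    (hY : AEStronglyMeasurable Y P)
    (h : Tendsto (fun n => eLpNorm (fun ω => X n ω - Y ω) 2 P) atTop (𝓝 0)) : MemLp Y 2 P := by
  obtain ⟨n, hn⟩ := (h.eventually_lt_const (u := 1) (by simp)).exists
  exact memLp_two_of_eLpNorm_sub_lt_top (hX n) hY (hn.trans (by simp))

/-- Means and variances pass to the `L²` limit, so the Gaussian characteristic functions converge to
the Gaussian one. Along an almost surely convergent subsequence they also converge, by domination,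
to that of `Y`. Degenerate laws are included. -/
theorem hasGaussianLaw_of_tendsto_eLpNorm [IsProbabilityMeasure P] {Z : ℕ → Ω → ℝ} {Y : Ω → ℝ}
    (hZ : ∀ n, HasGaussianLaw (Z n) P) (hY : AEStronglyMeasurable Y P)
    (h : Tendsto (fun n => eLpNorm (fun ω => Z n ω - Y ω) 2 P) atTop (𝓝 0)) :
    HasGaussianLaw Y P := by
  have hZ2 : ∀ n, MemLp (Z n) 2 P := fun n => (hZ n).memLp_two
  have hY2 : MemLp Y 2 P := memLp_two_of_tendsto hZ2 hY h
  have hone : MemLp (fun _ : Ω => (1 : ℝ)) 2 P := memLp_const 1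
  have hmean : Tendsto (fun n => ∫ ω, Z n ω ∂P) atTop (𝓝 (∫ ω, Y ω ∂P)) := by
    have := tendsto_integral_mul_of_tendsto_eLpNorm hZ2 (fun _ => hone) hY2 hone h (by simp)
    simpa using this
  have hvar : Tendsto (fun n => Var[Z n; P]) atTop (𝓝 (Var[Y; P])) := by
    have h2 := tendsto_integral_mul_of_tendsto_eLpNorm hZ2 hZ2 hY2 hY2 h h
    have := h2.sub (hmean.pow 2)
    simp only [variance_eq_sub hY2, fun n => variance_eq_sub (hZ2 n)]
    simpa [pow_two] using this
  have hmeas : TendstoInMeasure P Z atTop Y :=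
    tendstoInMeasure_of_tendsto_eLpNorm (by simp) (fun n => (hZ2 n).1) hY h
  obtain ⟨ns, hns, hae⟩ := hmeas.exists_seq_tendsto_ae
  rw [hasGaussianLaw_iff_charFun_map_eq hY.aemeasurable]
  intro t
  have e1 : ∀ n, charFun (P.map (Z n)) t = ∫ ω, Complex.exp (t * Z n ω * Complex.I) ∂P := by
    intro n
    rw [charFun_apply_real, integral_map (hZ n).aemeasurable (by fun_prop)]
  have e2 : charFun (P.map Y) t = ∫ ω, Complex.exp (t * Y ω * Complex.I) ∂P := by
    rw [charFun_apply_real, integral_map hY.aemeasurable (by fun_prop)]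
  have lim1 : Tendsto (fun n => charFun (P.map (Z (ns n))) t) atTop (𝓝 (charFun (P.map Y) t)) := by
    simp only [e1, e2]
    refine tendsto_integral_of_dominated_convergence (fun _ => 1) (fun n => ?_)
      (integrable_const 1) (fun n => ?_) ?_
    · have := (hZ (ns n)).aemeasurable
      exact AEMeasurable.aestronglyMeasurable (by fun_prop)
    · refine Eventually.of_forall fun ω => ?_
      have := Complex.norm_exp_ofReal_mul_I (t * Z (ns n) ω)
      push_cast at this
      exact this.le
    · filter_upwards [hae] with ω hω
      have hc : Continuous fun x : ℝ => Complex.exp (t * x * Complex.I) := by fun_prop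
      exact (hc.tendsto _).comp hω
  have lim2 : Tendsto (fun n => charFun (P.map (Z (ns n))) t) atTop
      (𝓝 (Complex.exp (((t * ∫ ω, Y ω ∂P : ℝ) : ℂ) * Complex.I - ((t ^ 2 * Var[Y; P] : ℝ) : ℂ) / 2))) := by
    have e3 : ∀ n, charFun (P.map (Z n)) t =
        Complex.exp (((t * ∫ ω, Z n ω ∂P : ℝ) : ℂ) * Complex.I
          - ((t ^ 2 * Var[Z n; P] : ℝ) : ℂ) / 2) := by
      intro n
      rw [(hZ n).charFun_map_eq]
      simp [mul_comm, variance_const_mul, integral_const_mul]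
    simp only [e3]
    have hc : Continuous fun q : ℝ × ℝ =>
        Complex.exp (((t * q.1 : ℝ) : ℂ) * Complex.I - ((t ^ 2 * q.2 : ℝ) : ℂ) / 2) := by fun_prop
    exact (hc.tendsto _).comp ((hmean.comp hns.tendsto_atTop).prodMk_nhds
      (hvar.comp hns.tendsto_atTop))
  rw [tendsto_nhds_unique lim1 lim2]
  simp [mul_comm, variance_const_mul, integral_const_mul]

/-- Joint Gaussianity is tested on linear functionals of finite subfamilies, each of which is an
`L²` limit of Gaussian variables. -/
theorem isGaussianProcess_of_tendsto_eLpNorm [IsProbabilityMeasure P] {S : Type*}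
    {Z : S → ℕ → Ω → ℝ} {Y : S → Ω → ℝ}
    (hZ : ∀ n, IsGaussianProcess (fun s => Z s n) P) (hY : ∀ s, AEStronglyMeasurable (Y s) P)
    (h : ∀ s, Tendsto (fun n => eLpNorm (fun ω => Z s n ω - Y s ω) 2 P) atTop (𝓝 0)) :
    IsGaussianProcess Y P := by
  classical
  refine ⟨fun I => ?_⟩
  have hYm : AEMeasurable (fun ω => I.restrict (Y · ω)) P :=
    aemeasurable_pi_lambda _ fun s => (hY s).aemeasurable
  refine ⟨?_⟩
  have : IsProbabilityMeasure (P.map fun ω => I.restrict (Y · ω)) :=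
    Measure.isProbabilityMeasure_map hYm
  refine isGaussian_of_isGaussian_map fun L => ?_
  rw [AEMeasurable.map_map_of_aemeasurable (by fun_prop) hYm]
  have hL : ∀ x : I → ℝ, L x = ∑ i : I, x i * L (Pi.single i 1) := by
    intro x
    conv_lhs => rw [← Finset.univ_sum_single x]
    rw [map_sum]
    refine Finset.sum_congr rfl fun i _ => ?_
    have : Pi.single i (x i) = x i • (Pi.single i 1 : I → ℝ) := by
      rw [← Pi.single_smul]; simp
    rw [this, map_smul, smul_eq_mul]
  have hZm : ∀ s n, AEStronglyMeasurable (Z s n) P := fun s n =>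
    ((hZ n).aemeasurable s).aestronglyMeasurable
  have key : HasGaussianLaw (L ∘ fun ω => I.restrict (Y · ω)) P := by
    refine hasGaussianLaw_of_tendsto_eLpNorm
      (Z := fun n => L ∘ fun ω => I.restrict (fun s => Z s n ω))
      (fun n => ((hZ n).hasGaussianLaw I).map L)
      (AEMeasurable.aestronglyMeasurable (by fun_prop)) ?_
    have hlim : Tendsto (fun n => ∑ i : I, eLpNorm (fun ω => L (Pi.single i 1) *
        (Z i n ω - Y i ω)) 2 P) atTop (𝓝 0) := by
      have : Tendsto (fun n => ∑ i : I, ‖L (Pi.single i 1)‖ₑ *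
        eLpNorm (fun ω => (Z i n ω - Y i ω)) 2 P) atTop (𝓝 (∑ i : I, ‖L (Pi.single i 1)‖ₑ * 0)) :=
        tendsto_finsetSum _ fun i _ => ENNReal.Tendsto.const_mul (h i) (Or.inr (by simp))
      simp only [mul_zero, Finset.sum_const_zero] at this
      refine this.congr fun n => Finset.sum_congr rfl fun i _ => ?_
      rw [← eLpNorm_const_smul]; rfl
    refine tendsto_of_tendsto_of_tendsto_of_le_of_le tendsto_const_nhds hlim (fun _ => zero_le)
      fun n => ?_
    have e : (fun ω => (L ∘ fun ω => I.restrict (fun s => Z s n ω)) ω -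
        (L ∘ fun ω => I.restrict (Y · ω)) ω) =
        ∑ i : I, fun ω => L (Pi.single i 1) * (Z i n ω - Y i ω) := by
      ext ω
      simp only [Function.comp_apply, Finset.sum_apply]
      rw [← map_sub, hL]
      refine Finset.sum_congr rfl fun i _ => ?_
      simp [mul_comm]
    simp only [e]
    exact eLpNorm_sum_le (fun i _ => ((hZm i n).sub (hY i)).const_mul _) (by norm_num)
  exact key.isGaussian_map

end GaussianLimits

/-! ### Cauchy–Schwarz for kernels that are superpositions of squares. -/

section CauchySchwarz

variable {R Y Q : Type*} [MeasurableSpace R] [MeasurableSpace Y] [MeasurableSpace Q]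
  {μ : Measure R} {ν : Measure Y} {ξ : Measure Q} [SFinite ν] [SFinite ξ]

/-- A kernel of the form `K y z = ∫ κ(q,y) κ(q,z) ξ(dq)` diagonalizes the energy form. -/
theorem lintegral_kernel_eq {K : Y → Y → ℝ≥0∞} {κ : Q → Y → ℝ≥0∞}
    (hκ : Measurable (Function.uncurry κ))
    (hK : ∀ y, ∀ᵐ z ∂ν, K y z = ∫⁻ q, κ q y * κ q z ∂ξ)
    {u v : R → Y → ℝ≥0∞} (hu : Measurable (Function.uncurry u))
    (hv : Measurable (Function.uncurry v)) :
    ∫⁻ r, ∫⁻ y, ∫⁻ z, u r y * K y z * v r z ∂ν ∂ν ∂μ =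
      ∫⁻ p : R × Q, (∫⁻ y, u p.1 y * κ p.2 y ∂ν) * (∫⁻ y, v p.1 y * κ p.2 y ∂ν) ∂(μ.prod ξ) := by
  have m1 : Measurable fun p : (R × Q) × Y => u p.1.1 p.2 * κ p.1.2 p.2 :=
    (hu.comp (by fun_prop : Measurable fun p : (R × Q) × Y => (p.1.1, p.2))).mul
      (hκ.comp (by fun_prop : Measurable fun p : (R × Q) × Y => (p.1.2, p.2)))
  have m2 : Measurable fun p : (R × Q) × Y => v p.1.1 p.2 * κ p.1.2 p.2 :=
    (hv.comp (by fun_prop : Measurable fun p : (R × Q) × Y => (p.1.1, p.2))).mul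
      (hκ.comp (by fun_prop : Measurable fun p : (R × Q) × Y => (p.1.2, p.2)))
  have m3 := m1.lintegral_prod_right' (ν := ν)
  have m4 := m2.lintegral_prod_right' (ν := ν)
  rw [lintegral_prod _ (by exact (m3.mul m4).aemeasurable)]
  refine lintegral_congr fun r => ?_
  have mu : Measurable (u r) := hu.of_uncurry_left
  have mv : Measurable (v r) := hv.of_uncurry_left
  have mκ : ∀ q, Measurable (κ q) := fun q => hκ.of_uncurry_left
  have mκ' : ∀ y, Measurable (fun q => κ q y) := fun q => hκ.of_uncurry_right
  have m5 : Measurable fun q => ∫⁻ y, v r y * κ q y ∂ν :=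
    m4.comp (by fun_prop : Measurable fun q : Q => (r, q))
  calc
    ∫⁻ y, ∫⁻ z, u r y * K y z * v r z ∂ν ∂ν
      = ∫⁻ y, ∫⁻ z, ∫⁻ q, u r y * κ q y * (v r z * κ q z) ∂ξ ∂ν ∂ν := by
        refine lintegral_congr fun y => lintegral_congr_ae ?_
        filter_upwards [hK y] with z hz
        rw [hz, ← lintegral_const_mul _ (by exact (mκ' y).mul (mκ' z)),
          ← lintegral_mul_const _ (by exact ((mκ' y).mul (mκ' z)).const_mul _)]
        refine lintegral_congr fun q => ?_
        ring
    _ = ∫⁻ y, ∫⁻ q, u r y * κ q y * (∫⁻ z, v r z * κ q z ∂ν) ∂ξ ∂ν := by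
        refine lintegral_congr fun y => ?_
        rw [lintegral_lintegral_swap]
        · refine lintegral_congr fun q => ?_
          rw [lintegral_const_mul _ (by exact mv.mul (mκ q))]
        · have a1 : Measurable fun p : Y × Q => κ p.2 y := (mκ' y).comp measurable_snd
          have a2 : Measurable fun p : Y × Q => κ p.2 p.1 := hκ.comp measurable_swap
          have a3 : Measurable fun p : Y × Q => v r p.1 := mv.comp measurable_fst
          exact ((a1.const_mul _).mul (a3.mul a2)).aemeasurable
    _ = ∫⁻ q, ∫⁻ y, u r y * κ q y * (∫⁻ z, v r z * κ q z ∂ν) ∂ν ∂ξ := by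
        rw [lintegral_lintegral_swap]
        have a2 : Measurable fun p : Y × Q => κ p.2 p.1 := hκ.comp measurable_swap
        have a3 : Measurable fun p : Y × Q => u r p.1 := mu.comp measurable_fst
        exact ((a3.mul a2).mul (m5.comp measurable_snd)).aemeasurable
    _ = _ := by
        refine lintegral_congr fun q => ?_
        rw [lintegral_mul_const _ (by exact mu.mul (mκ q))]

/-- After diagonalization this is Hölder's inequality with exponents `2, 2` on `μ.prod ξ`. -/
theorem lintegral_kernel_le {K : Y → Y → ℝ≥0∞} {κ : Q → Y → ℝ≥0∞}
    (hκ : Measurable (Function.uncurry κ))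
    (hK : ∀ y, ∀ᵐ z ∂ν, K y z = ∫⁻ q, κ q y * κ q z ∂ξ)
    {u v : R → Y → ℝ≥0∞} (hu : Measurable (Function.uncurry u))
    (hv : Measurable (Function.uncurry v)) :
    ∫⁻ r, ∫⁻ y, ∫⁻ z, u r y * K y z * v r z ∂ν ∂ν ∂μ ≤
      (∫⁻ r, ∫⁻ y, ∫⁻ z, u r y * K y z * u r z ∂ν ∂ν ∂μ) ^ (1 / 2 : ℝ) *
      (∫⁻ r, ∫⁻ y, ∫⁻ z, v r y * K y z * v r z ∂ν ∂ν ∂μ) ^ (1 / 2 : ℝ) := by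
  rw [lintegral_kernel_eq hκ hK hu hv, lintegral_kernel_eq hκ hK hu hu,
    lintegral_kernel_eq hκ hK hv hv]
  have m : ∀ {w : R → Y → ℝ≥0∞}, Measurable (Function.uncurry w) →
      Measurable fun p : R × Q => ∫⁻ y, w p.1 y * κ p.2 y ∂ν := fun hw =>
    ((hw.comp (by fun_prop : Measurable fun p : (R × Q) × Y => (p.1.1, p.2))).mul
      (hκ.comp (by fun_prop : Measurable fun p : (R × Q) × Y => (p.1.2, p.2)))).lintegral_prod_right'
  have := ENNReal.lintegral_mul_le_Lp_mul_Lq (μ.prod ξ) Real.HolderConjugate.two_two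
    (m hu).aemeasurable (m hv).aemeasurable
  simpa only [Pi.mul_apply, ENNReal.rpow_two, pow_two] using this

end CauchySchwarz

/-! ### The Riesz kernel as a superposition of Gaussians. -/

section RieszKernel

variable {k : ℕ}

theorem lintegral_exp_neg_mul_sq_norm {b : ℝ} (hb : 0 < b) :
    ∫⁻ w : Eucl k, ENNReal.ofReal (Real.exp (-b * ‖w‖ ^ 2)) =
      ENNReal.ofReal ((Real.pi / b) ^ ((k : ℝ) / 2)) := by
  have h := GaussianFourier.integral_rexp_neg_mul_sq_norm (V := Eucl k) hb
  rw [finrank_euclideanSpace_fin] at h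
  have hi : Integrable fun w : Eucl k => Real.exp (-b * ‖w‖ ^ 2) := by
    -- A non-integrable function has Bochner integral `0`, so a positive value of the integral
    -- forces integrability.
    by_contra hc
    rw [integral_undef hc] at h
    have : 0 < (Real.pi / b) ^ ((k : ℝ) / 2) := by positivity
    exact this.ne h
  rw [← h, ofReal_integral_eq_lintegral_ofReal hi]
  exact Eventually.of_forall fun _ => (Real.exp_pos _).le

/-- The square root of the Riesz kernel as a superposition of Gaussians. -/
def rieszRoot (β : ℝ) (q : ℝ × Eucl k) (y : Eucl k) : ℝ≥0∞ :=
  ENNReal.ofReal (√(q.1 ^ (β / 2 - 1) / Real.Gamma (β / 2) * (4 * q.1 / Real.pi) ^ ((k : ℝ) / 2)) *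
    Real.exp (-(2 * q.1) * ‖y - q.2‖ ^ 2))

theorem measurable_rieszRoot (β : ℝ) :
    Measurable (Function.uncurry (rieszRoot (k := k) β)) := by
  unfold rieszRoot Function.uncurry
  fun_prop

/-- By the parallelogram law, the product of two Gaussians centred at `y` and `z` is a Gaussian in
`w` centred at their midpoint, times `exp(-τ‖y-z‖²)`. The factor `(4τ/π)^{k/2}` cancels the integral
over `w`, and the integral over `τ` is Euler's integral for `Γ(β/2)`. On the diagonal the identity
fails, since `0 ^ (-β)` is `0` by convention. -/
theorem lintegral_rieszRoot_mul {β : ℝ} (hβ : 0 < β) {y z : Eucl k} (hyz : y ≠ z) :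
    ∫⁻ q, rieszRoot β q y * rieszRoot β q z
        ∂((volume.restrict (Set.Ioi (0 : ℝ))).prod (volume : Measure (Eucl k))) =
      ENNReal.ofReal (‖y - z‖ ^ (-β)) := by
  have m : ∀ y, Measurable fun q => rieszRoot (k := k) β q y := fun y =>
    (measurable_rieszRoot β).of_uncurry_right
  rw [lintegral_prod _ (by exact ((m y).mul (m z)).aemeasurable)]
  have hn : 0 < ‖y - z‖ := norm_pos_iff.2 (sub_ne_zero.2 hyz)
  have inner : ∀ τ ∈ Set.Ioi (0 : ℝ), ∫⁻ w, rieszRoot β (τ, w) y * rieszRoot β (τ, w) z =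
      ENNReal.ofReal ((τ ^ (β / 2 - 1) * Real.exp (-(‖y - z‖ ^ 2 * τ))) / Real.Gamma (β / 2)) := by
    intro τ hτ
    have hτ' : 0 < τ := hτ
    set W := τ ^ (β / 2 - 1) / Real.Gamma (β / 2) * (4 * τ / Real.pi) ^ ((k : ℝ) / 2) with hW
    have hG : 0 < Real.Gamma (β / 2) := Real.Gamma_pos_of_pos (by positivity)
    have hW0 : 0 ≤ W := by positivity
    have e : ∀ w, rieszRoot β (τ, w) y * rieszRoot β (τ, w) z =
        ENNReal.ofReal (W * Real.exp (-(‖y - z‖ ^ 2 * τ))) *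
          ENNReal.ofReal (Real.exp (-(4 * τ) * ‖w - (1 / 2 : ℝ) • (y + z)‖ ^ 2)) := by
      intro w
      rw [rieszRoot, rieszRoot, ← ENNReal.ofReal_mul (by positivity),
        ← ENNReal.ofReal_mul (by positivity)]
      congr 1
      change √W * _ * (√W * _) = _
      have : ‖y - w‖ ^ 2 + ‖z - w‖ ^ 2 =
          2 * ‖w - (1 / 2 : ℝ) • (y + z)‖ ^ 2 + ‖y - z‖ ^ 2 / 2 := by
        have h := parallelogram_law_with_norm ℝ (w - y) (w - z)
        have h1 : w - y + (w - z) = (2 : ℝ) • (w - (1 / 2 : ℝ) • (y + z)) := by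
          rw [smul_sub, smul_smul, two_smul]; norm_num; abel
        have h2 : w - y - (w - z) = -(y - z) := by abel
        rw [h1, h2, norm_neg, norm_smul, norm_sub_rev w y, norm_sub_rev w z] at h
        rw [Real.norm_eq_abs, abs_of_pos two_pos] at h
        linarith
      rw [mul_mul_mul_comm, Real.mul_self_sqrt hW0, mul_assoc W, ← Real.exp_add, ← Real.exp_add]
      congr 2
      linear_combination (-2 * τ) * this
    simp_rw [e]
    rw [lintegral_const_mul _ (by fun_prop),
      lintegral_sub_right_eq_self
        (fun w : Eucl k => ENNReal.ofReal (Real.exp (-(4 * τ) * ‖w‖ ^ 2))),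
      lintegral_exp_neg_mul_sq_norm (by positivity), ← ENNReal.ofReal_mul (by positivity)]
    congr 1
    have : (4 * τ / Real.pi) ^ ((k : ℝ) / 2) * (Real.pi / (4 * τ)) ^ ((k : ℝ) / 2) = 1 := by
      rw [← Real.mul_rpow (by positivity) (by positivity)]
      have : 4 * τ / Real.pi * (Real.pi / (4 * τ)) = 1 := by field_simp
      rw [this, Real.one_rpow]
    rw [hW]
    linear_combination (τ ^ (β / 2 - 1) / Real.Gamma (β / 2) * Real.exp (-(‖y - z‖ ^ 2 * τ))) * this
  rw [setLIntegral_congr_fun measurableSet_Ioi inner]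
  have hG : 0 < Real.Gamma (β / 2) := Real.Gamma_pos_of_pos (by positivity)
  have h := Real.integral_rpow_mul_exp_neg_mul_Ioi (a := β / 2) (by positivity)
    (by positivity : 0 < ‖y - z‖ ^ 2)
  have hi : IntegrableOn (fun τ : ℝ => τ ^ (β / 2 - 1) * Real.exp (-(‖y - z‖ ^ 2 * τ)))
      (Set.Ioi 0) := by
    by_contra hc
    rw [integral_undef hc] at h
    have : 0 < (1 / ‖y - z‖ ^ 2) ^ (β / 2) * Real.Gamma (β / 2) := by positivity
    exact this.ne h
  rw [← ofReal_integral_eq_lintegral_ofReal (hi.div_const _), integral_div, h]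
  · congr 1
    rw [mul_div_assoc, div_self hG.ne', mul_one, one_div, ← Real.rpow_natCast, ← Real.rpow_neg hn.le,
      ← Real.rpow_mul hn.le]
    congr 1
    push_cast
    ring
  · refine (ae_restrict_mem measurableSet_Ioi).mono fun τ hτ => ?_
    have : (0 : ℝ) < τ := hτ
    positivity

end RieszKernel

/-! ### Riesz potentials of balls. -/

section Potential

variable {k : ℕ}

theorem lintegral_comp_smul_eucl (f : Eucl k → ℝ≥0∞) {c : ℝ} (hc : 0 < c) :
    ∫⁻ x, f (c • x) = ENNReal.ofReal (c ^ (-(k : ℝ))) * ∫⁻ x, f x := by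
  have e := (Homeomorph.smulOfNeZero c hc.ne' : Eucl k ≃ₜ Eucl k).measurableEmbedding
  have h := e.lintegral_map (μ := volume) f
  have h2 : Measure.map (⇑(Homeomorph.smulOfNeZero c hc.ne' : Eucl k ≃ₜ Eucl k)) volume =
      ENNReal.ofReal (c ^ (-(k : ℝ))) • volume := by
    have := Measure.map_addHaar_smul (volume : Measure (Eucl k)) hc.ne'
    rw [finrank_euclideanSpace_fin, abs_of_pos (by positivity), ← Real.rpow_natCast,
      ← Real.rpow_neg hc.le] at this
    exact this
  rw [h2, lintegral_smul_measure] at h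
  exact h.symm

theorem volume_ball_eucl (x : Eucl k) {ρ : ℝ} (hρ : 0 < ρ) :
    volume (Metric.ball x ρ) =
      ENNReal.ofReal (ρ ^ (k : ℝ)) * volume (Metric.ball (0 : Eucl k) 1) := by
  rw [Measure.addHaar_ball_of_pos _ _ hρ, finrank_euclideanSpace_fin, Real.rpow_natCast]

/-- In polar coordinates the integrand is `r^{k-1-β}`, which is integrable at `0` because `β < k`.
-/
theorem lintegral_ball_zero_one_rpow_lt_top {β : ℝ} (hk : 0 < k) (hβk : β < k) :
    ∫⁻ w in Metric.ball (0 : Eucl k) 1, ENNReal.ofReal (‖w‖ ^ (-β)) < ∞ := by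
  have : Nonempty (Fin k) := ⟨⟨0, hk⟩⟩
  have hi : IntegrableOn (fun w : Eucl k => ‖w‖ ^ (-β)) (Metric.ball 0 1) := by
    rw [integrableOn_fun_norm_addHaar volume (f := fun y : ℝ => y ^ (-β)),
      finrank_euclideanSpace_fin]
    have h2 : IntegrableOn (fun y : ℝ => y ^ ((k : ℝ) - 1 - β)) (Set.Ioo 0 1) :=
      (intervalIntegral.integrableOn_Ioo_rpow_iff one_pos).2 (by linarith)
    refine h2.congr_fun (fun y hy => ?_) measurableSet_Ioo
    have hy0 : 0 < y := hy.1
    simp only [smul_eq_mul]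
    rw [← Real.rpow_natCast, ← Real.rpow_add hy0, Nat.cast_sub hk]
    push_cast
    ring_nf
  have := hi.2
  rw [hasFiniteIntegral_iff_ofReal (Eventually.of_forall fun w => by positivity)] at this
  exact this

theorem lintegral_ball_zero_rpow {β ρ : ℝ} (hρ : 0 < ρ) :
    ∫⁻ w in Metric.ball (0 : Eucl k) ρ, ENNReal.ofReal (‖w‖ ^ (-β)) =
      ENNReal.ofReal (ρ ^ ((k : ℝ) - β)) *
        ∫⁻ w in Metric.ball (0 : Eucl k) 1, ENNReal.ofReal (‖w‖ ^ (-β)) := by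
  have h := lintegral_comp_smul_eucl
    ((Metric.ball (0 : Eucl k) 1).indicator fun w => ENNReal.ofReal (‖w‖ ^ (-β)))
    (inv_pos.2 hρ)
  rw [lintegral_indicator measurableSet_ball] at h
  rw [← lintegral_indicator measurableSet_ball]
  have e : ∀ x : Eucl k, (Metric.ball (0 : Eucl k) ρ).indicator
      (fun w => ENNReal.ofReal (‖w‖ ^ (-β))) x = ENNReal.ofReal (ρ ^ (-β)) *
      (Metric.ball (0 : Eucl k) 1).indicator (fun w => ENNReal.ofReal (‖w‖ ^ (-β))) (ρ⁻¹ • x) := by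
    intro x
    have hmem : ρ⁻¹ • x ∈ Metric.ball (0 : Eucl k) 1 ↔ x ∈ Metric.ball (0 : Eucl k) ρ := by
      rw [mem_ball_zero_iff, mem_ball_zero_iff, norm_smul, Real.norm_eq_abs,
        abs_of_pos (inv_pos.2 hρ), inv_mul_lt_iff₀ hρ, mul_one]
    by_cases hx : x ∈ Metric.ball (0 : Eucl k) ρ
    · rw [Set.indicator_of_mem hx, Set.indicator_of_mem (hmem.2 hx),
        ← ENNReal.ofReal_mul (by positivity), norm_smul, Real.norm_eq_abs,
        abs_of_pos (inv_pos.2 hρ), ← Real.mul_rpow hρ.le (by positivity)]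
      congr 2
      field_simp
    · rw [Set.indicator_of_notMem hx, Set.indicator_of_notMem (fun h' => hx (hmem.1 h')), mul_zero]
  simp_rw [e]
  rw [lintegral_const_mul', h, ← mul_assoc, ← ENNReal.ofReal_mul (by positivity)]
  · congr 2
    rw [Real.inv_rpow hρ.le, Real.rpow_neg hρ.le (k : ℝ), inv_inv, ← Real.rpow_add hρ]
    ring_nf
  · exact ENNReal.ofReal_ne_top

/-- The Riesz potential of a ball of radius `ρ` is bounded by a multiple of `ρ^{k-β}`. -/
theorem exists_lintegral_ball_rpow_le {β : ℝ} (hβ0 : 0 < β) (hβk : β < k) :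
    ∃ C : ℝ, 0 < C ∧ ∀ ρ : ℝ, 0 < ρ → ∀ x y : Eucl k,
      ∫⁻ z in Metric.ball x ρ, ENNReal.ofReal (‖y - z‖ ^ (-β)) ≤
        ENNReal.ofReal (C * ρ ^ ((k : ℝ) - β)) := by
  have hk : 0 < k := by
    have : (0 : ℝ) < k := hβ0.trans hβk
    exact_mod_cast this
  set A := ∫⁻ w in Metric.ball (0 : Eucl k) 1, ENNReal.ofReal (‖w‖ ^ (-β)) with hA
  have hAt : A < ∞ := lintegral_ball_zero_one_rpow_lt_top hk hβk
  set V := volume (Metric.ball (0 : Eucl k) 1) with hV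
  have hVt : V < ∞ := measure_ball_lt_top
  refine ⟨A.toReal + V.toReal + 1, by positivity, fun ρ hρ x y => ?_⟩
  -- The position of `y` relative to the ball is arbitrary: points within `ρ` of `y` are absorbed in
  -- a ball centred at `y`, and elsewhere the kernel is at most `ρ^{-β}`.
  have hle : ∀ z ∈ Metric.ball x ρ, ENNReal.ofReal (‖y - z‖ ^ (-β)) ≤
      (Metric.ball (0 : Eucl k) ρ).indicator (fun w => ENNReal.ofReal (‖w‖ ^ (-β))) (z - y) +
        ENNReal.ofReal (ρ ^ (-β)) := by
    intro z _
    by_cases hz : z - y ∈ Metric.ball (0 : Eucl k) ρ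
    · rw [Set.indicator_of_mem hz, norm_sub_rev]
      exact le_self_add
    · rw [Set.indicator_of_notMem hz, zero_add]
      refine ENNReal.ofReal_le_ofReal ?_
      rw [mem_ball_zero_iff, not_lt, norm_sub_rev] at hz
      exact Real.rpow_le_rpow_of_nonpos hρ hz (by linarith)
  calc
    _ ≤ ∫⁻ z in Metric.ball x ρ, ((Metric.ball (0 : Eucl k) ρ).indicator
          (fun w => ENNReal.ofReal (‖w‖ ^ (-β))) (z - y) + ENNReal.ofReal (ρ ^ (-β))) :=
        setLIntegral_mono' measurableSet_ball hle
    _ = (∫⁻ z in Metric.ball x ρ, ((Metric.ball (0 : Eucl k) ρ).indicator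
          (fun w => ENNReal.ofReal (‖w‖ ^ (-β))) (z - y))) +
          ENNReal.ofReal (ρ ^ (-β)) * volume (Metric.ball x ρ) := by
        rw [lintegral_add_right _ measurable_const, setLIntegral_const]
    _ ≤ (∫⁻ z, ((Metric.ball (0 : Eucl k) ρ).indicator
          (fun w => ENNReal.ofReal (‖w‖ ^ (-β))) (z - y))) +
          ENNReal.ofReal (ρ ^ (-β)) * volume (Metric.ball x ρ) := by
        gcongr
        exact Measure.restrict_le_self
    _ = ENNReal.ofReal (ρ ^ ((k : ℝ) - β)) * A + ENNReal.ofReal (ρ ^ ((k : ℝ) - β)) * V := by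
        rw [lintegral_sub_right_eq_self ((Metric.ball (0 : Eucl k) ρ).indicator
          (fun w => ENNReal.ofReal (‖w‖ ^ (-β)))), lintegral_indicator measurableSet_ball,
          lintegral_ball_zero_rpow hρ, volume_ball_eucl x hρ, ← mul_assoc,
          ← ENNReal.ofReal_mul (by positivity), ← Real.rpow_add hρ, neg_add_eq_sub]
    _ = ENNReal.ofReal ((A.toReal + V.toReal) * ρ ^ ((k : ℝ) - β)) := by
        rw [← mul_add, mul_comm, ENNReal.ofReal_mul (by positivity),
          ENNReal.ofReal_add (by positivity) (by positivity), ENNReal.ofReal_toReal hAt.ne,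
          ENNReal.ofReal_toReal hVt.ne]
    _ ≤ _ := by
        refine ENNReal.ofReal_le_ofReal ?_
        exact mul_le_mul_of_nonneg_right (le_add_of_nonneg_right zero_le_one) (by positivity)

end Potential

/-! ### Mutual energy and the signed Riesz form. -/

section Form

variable {k : ℕ}

/-- `∫_I dr ∫ dy ∫ dz |u(r,y)| ‖y - z‖^{-β} |v(r,z)|`. -/
def rieszMutual (β : ℝ) (I : Set ℝ) (u v : ℝ → Eucl k → ℝ) : ℝ≥0∞ :=
  ∫⁻ r in I, ∫⁻ y, ∫⁻ z, ENNReal.ofReal (|u r y| * ‖y - z‖ ^ (-β) * |v r z|)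

/-- The integrand `u(r,y) ‖y - z‖^{-β} v(r,z)`. -/
def rieszIntegrand (β : ℝ) (u v : ℝ → Eucl k → ℝ) (p : ℝ × Eucl k × Eucl k) : ℝ :=
  u p.1 p.2.1 * ‖p.2.1 - p.2.2‖ ^ (-β) * v p.1 p.2.2

/-- The product measure `1_I(r) dr dy dz`. -/
abbrev rieszMeasure (k : ℕ) (I : Set ℝ) : Measure (ℝ × Eucl k × Eucl k) :=
  (volume.restrict I).prod (volume.prod volume)

/-- `∫_I dr ∫ dy ∫ dz u(r,y) ‖y - z‖^{-β} v(r,z)`. -/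
def rieszForm (β : ℝ) (I : Set ℝ) (u v : ℝ → Eucl k → ℝ) : ℝ :=
  ∫ p, rieszIntegrand β u v p ∂(rieszMeasure k I)

variable {β : ℝ} {I : Set ℝ} {u v : ℝ → Eucl k → ℝ}

theorem measurable_rieszIntegrand (hu : Measurable (Function.uncurry u))
    (hv : Measurable (Function.uncurry v)) : Measurable (rieszIntegrand β u v) := by
  have h1 : Measurable fun p : ℝ × Eucl k × Eucl k => u p.1 p.2.1 :=
    hu.comp (by fun_prop : Measurable fun p : ℝ × Eucl k × Eucl k => (p.1, p.2.1))
  have h2 : Measurable fun p : ℝ × Eucl k × Eucl k => v p.1 p.2.2 :=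
    hv.comp (by fun_prop : Measurable fun p : ℝ × Eucl k × Eucl k => (p.1, p.2.2))
  unfold rieszIntegrand
  fun_prop

theorem rieszMutual_eq_lintegral (hu : Measurable (Function.uncurry u))
    (hv : Measurable (Function.uncurry v)) :
    rieszMutual β I u v = ∫⁻ p, ‖rieszIntegrand β u v p‖ₑ ∂(rieszMeasure k I) := by
  have m := (measurable_rieszIntegrand (β := β) hu hv).enorm
  rw [lintegral_prod _ m.aemeasurable, rieszMutual]
  refine lintegral_congr fun r => ?_
  rw [lintegral_prod]
  · refine lintegral_congr fun y => lintegral_congr fun z => ?_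
    rw [rieszIntegrand, ← ofReal_norm, norm_mul, norm_mul, Real.norm_eq_abs,
      Real.norm_eq_abs, Real.norm_eq_abs, abs_of_nonneg (by positivity : 0 ≤ ‖y - z‖ ^ (-β))]
  · exact (m.comp (by fun_prop : Measurable fun q : Eucl k × Eucl k => (r, q))).aemeasurable

theorem integrable_rieszIntegrand (hu : Measurable (Function.uncurry u))
    (hv : Measurable (Function.uncurry v)) (h : rieszMutual β I u v < ∞) :
    Integrable (rieszIntegrand β u v) (rieszMeasure k I) :=
  ⟨(measurable_rieszIntegrand hu hv).aestronglyMeasurable, by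
    rw [rieszMutual_eq_lintegral hu hv] at h; exact h⟩

theorem enorm_rieszForm_le (hu : Measurable (Function.uncurry u))
    (hv : Measurable (Function.uncurry v)) : ‖rieszForm β I u v‖ₑ ≤ rieszMutual β I u v := by
  rw [rieszMutual_eq_lintegral hu hv]
  exact enorm_integral_le_lintegral_enorm _

/-- The covariance of `F` is an iterated Bochner integral, while the form lives on the product
space, where linearity is direct. Fubini identifies them under absolute convergence. -/
theorem rieszForm_eq_iterated (hu : Measurable (Function.uncurry u))
    (hv : Measurable (Function.uncurry v)) (h : rieszMutual β I u v < ∞) :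
    rieszForm β I u v = ∫ r in I, ∫ y, ∫ z, u r y * ‖y - z‖ ^ (-β) * v r z := by
  have hi := integrable_rieszIntegrand hu hv h
  rw [rieszForm, integral_prod _ hi]
  refine integral_congr_ae ?_
  filter_upwards [hi.prod_right_ae] with r hr
  rw [integral_prod _ hr]
  rfl

/-- The Cauchy–Schwarz inequality for the Riesz energy. -/
theorem rieszMutual_le (hk : 0 < k) (hβ : 0 < β) (hu : Measurable (Function.uncurry u))
    (hv : Measurable (Function.uncurry v)) :
    rieszMutual β I u v ≤ rieszEnergy β I u ^ (1 / 2 : ℝ) * rieszEnergy β I v ^ (1 / 2 : ℝ) := by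
  have : Nonempty (Fin k) := ⟨⟨0, hk⟩⟩
  have e : ∀ u v : ℝ → Eucl k → ℝ, ∀ r y z, ENNReal.ofReal (|u r y| * ‖y - z‖ ^ (-β) * |v r z|) =
      ‖u r y‖ₑ * ENNReal.ofReal (‖y - z‖ ^ (-β)) * ‖v r z‖ₑ := by
    intro u v r y z
    rw [ENNReal.ofReal_mul (by positivity), ENNReal.ofReal_mul (by positivity),
      ← Real.norm_eq_abs, ← Real.norm_eq_abs, ofReal_norm, ofReal_norm]
  simp only [rieszMutual, rieszEnergy, e]
  refine lintegral_kernel_le (u := fun r y => ‖u r y‖ₑ) (v := fun r y => ‖v r y‖ₑ)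
    (K := fun y z => ENNReal.ofReal (‖y - z‖ ^ (-β)))
    (ξ := (volume.restrict (Set.Ioi (0 : ℝ))).prod (volume : Measure (Eucl k)))
    (measurable_rieszRoot β) (fun y => ?_) hu.enorm hv.enorm
  -- Points are null because `k > 0`, so the failure of the kernel identity on the diagonal is
  -- harmless.
  have : ∀ᵐ z : Eucl k, z ≠ y := by simp [ae_iff]
  filter_upwards [this] with z hz
  exact (lintegral_rieszRoot_mul hβ hz.symm).symm

theorem rieszMutual_lt_top (hk : 0 < k) (hβ : 0 < β) (hu : Measurable (Function.uncurry u))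
    (hv : Measurable (Function.uncurry v)) (h1 : rieszEnergy β I u < ∞)
    (h2 : rieszEnergy β I v < ∞) : rieszMutual β I u v < ∞ :=
  (rieszMutual_le hk hβ hu hv).trans_lt <|
    ENNReal.mul_lt_top (ENNReal.rpow_lt_top_of_nonneg (by norm_num) h1.ne)
      (ENNReal.rpow_lt_top_of_nonneg (by norm_num) h2.ne)

end Form

/-! ### Bilinearity and continuity of the form in energy. -/

section Bilinear

variable {k : ℕ} {β : ℝ} {I : Set ℝ} {u v w u' v' : ℝ → Eucl k → ℝ}

theorem rieszMutual_lt_top_of_integrable (hu : Measurable (Function.uncurry u))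
    (hv : Measurable (Function.uncurry v))
    (h : Integrable (rieszIntegrand β u v) (rieszMeasure k I)) : rieszMutual β I u v < ∞ := by
  rw [rieszMutual_eq_lintegral hu hv]
  exact h.2

theorem rieszForm_comm (u v : ℝ → Eucl k → ℝ) : rieszForm β I u v = rieszForm β I v u := by
  have hmp : MeasurePreserving (Prod.map id Prod.swap) (rieszMeasure k I) (rieszMeasure k I) :=
    (MeasurePreserving.id _).prod Measure.measurePreserving_swap
  have he : MeasurableEmbedding
      (Prod.map id Prod.swap : ℝ × Eucl k × Eucl k → ℝ × Eucl k × Eucl k) :=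
    MeasurableEquiv.measurableEmbedding
      ((MeasurableEquiv.refl ℝ).prodCongr MeasurableEquiv.prodComm)
  rw [rieszForm, rieszForm, ← hmp.integral_comp he]
  refine integral_congr_ae (Eventually.of_forall fun p => ?_)
  simp only [rieszIntegrand, Prod.map, id, Prod.fst_swap, Prod.snd_swap]
  rw [norm_sub_rev]
  ring

theorem rieszForm_sub_left (h1 : Integrable (rieszIntegrand β u w) (rieszMeasure k I))
    (h2 : Integrable (rieszIntegrand β v w) (rieszMeasure k I)) :
    rieszForm β I (fun r y => u r y - v r y) w = rieszForm β I u w - rieszForm β I v w := by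
  rw [rieszForm, rieszForm, rieszForm, ← integral_sub h1 h2]
  refine integral_congr_ae (Eventually.of_forall fun p => ?_)
  simp only [rieszIntegrand]
  ring

/-- Expansion of the form around a pair of functions of finite energy. -/
theorem rieszForm_expand (hk : 0 < k) (hβ : 0 < β)
    (hu : Measurable (Function.uncurry u)) (hv : Measurable (Function.uncurry v))
    (hu' : Measurable (Function.uncurry u')) (hv' : Measurable (Function.uncurry v'))
    (eu : rieszEnergy β I u' < ∞) (ev : rieszEnergy β I v' < ∞)
    (du : rieszEnergy β I (fun r y => u r y - u' r y) < ∞)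
    (dv : rieszEnergy β I (fun r y => v r y - v' r y) < ∞) :
    Integrable (rieszIntegrand β u v) (rieszMeasure k I) ∧
    rieszForm β I u v = rieszForm β I (fun r y => u r y - u' r y) (fun r y => v r y - v' r y) +
      rieszForm β I (fun r y => u r y - u' r y) v' +
      rieszForm β I u' (fun r y => v r y - v' r y) + rieszForm β I u' v' := by
  have mu : Measurable (Function.uncurry fun r y => u r y - u' r y) := hu.sub hu'
  have mv : Measurable (Function.uncurry fun r y => v r y - v' r y) := hv.sub hv'
  have i1 := integrable_rieszIntegrand mu mv (rieszMutual_lt_top hk hβ mu mv du dv)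
  have i2 := integrable_rieszIntegrand mu hv' (rieszMutual_lt_top hk hβ mu hv' du ev)
  have i3 := integrable_rieszIntegrand hu' mv (rieszMutual_lt_top hk hβ hu' mv eu dv)
  have i4 := integrable_rieszIntegrand hu' hv' (rieszMutual_lt_top hk hβ hu' hv' eu ev)
  have e : rieszIntegrand β u v = fun p =>
      rieszIntegrand β (fun r y => u r y - u' r y) (fun r y => v r y - v' r y) p +
      rieszIntegrand β (fun r y => u r y - u' r y) v' p +
      rieszIntegrand β u' (fun r y => v r y - v' r y) p + rieszIntegrand β u' v' p := by
    ext p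
    simp only [rieszIntegrand]
    ring
  constructor
  · rw [e]
    exact ((i1.add i2).add i3).add i4
  · rw [rieszForm, e]
    have i12 := i1.add i2
    have i123 := i12.add i3
    rw [integral_add (by exact i123) i4, integral_add (by exact i12) i3, integral_add i1 i2]
    rfl

theorem rieszEnergy_lt_top_of_sub (hk : 0 < k) (hβ : 0 < β)
    (hu : Measurable (Function.uncurry u)) (hu' : Measurable (Function.uncurry u'))
    (eu : rieszEnergy β I u' < ∞) (du : rieszEnergy β I (fun r y => u r y - u' r y) < ∞) :
    rieszEnergy β I u < ∞ :=
  rieszMutual_lt_top_of_integrable hu hu (rieszForm_expand hk hβ hu hu hu' hu' eu eu du du).1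

theorem tendsto_rieszForm_zero (hk : 0 < k) (hβ : 0 < β) {φ ψ : ℕ → ℝ → Eucl k → ℝ}
    (hφ : ∀ n, Measurable (Function.uncurry (φ n))) (hψ : ∀ n, Measurable (Function.uncurry (ψ n)))
    (lφ : Tendsto (fun n => rieszEnergy β I (φ n)) atTop (𝓝 0))
    {a : ℝ≥0∞} (ha : a ≠ ∞) (lψ : Tendsto (fun n => rieszEnergy β I (ψ n)) atTop (𝓝 a)) :
    Tendsto (fun n => rieszForm β I (φ n) (ψ n)) atTop (𝓝 0) := by
  rw [tendsto_zero_iff_enorm_tendsto_zero]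
  have l1 : Tendsto (fun n => rieszEnergy β I (φ n) ^ (1 / 2 : ℝ)) atTop (𝓝 0) := by
    have := (ENNReal.continuous_rpow_const (y := 1 / 2)).tendsto 0 |>.comp lφ
    simpa [Function.comp_def] using this
  have l2 : Tendsto (fun n => rieszEnergy β I (ψ n) ^ (1 / 2 : ℝ)) atTop (𝓝 (a ^ (1 / 2 : ℝ))) :=
    (ENNReal.continuous_rpow_const (y := 1 / 2)).tendsto a |>.comp lψ
  have l3 := ENNReal.Tendsto.mul l1 (Or.inr (ENNReal.rpow_ne_top_of_nonneg (by norm_num) ha)) l2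
    (Or.inr ENNReal.zero_ne_top)
  rw [zero_mul] at l3
  exact tendsto_of_tendsto_of_tendsto_of_le_of_le tendsto_const_nhds l3 (fun _ => zero_le)
    fun n => (enorm_rieszForm_le (hφ n) (hψ n)).trans (rieszMutual_le hk hβ (hφ n) (hψ n))

/-- Expand around `(u, v)`; each error term is controlled by Cauchy–Schwarz. The approximants need
no finite-energy hypothesis: it holds as soon as their distance to the limit is finite. -/
theorem tendsto_rieszForm (hk : 0 < k) (hβ : 0 < β) {φ ψ : ℕ → ℝ → Eucl k → ℝ}
    (hφ : ∀ n, Measurable (Function.uncurry (φ n))) (hψ : ∀ n, Measurable (Function.uncurry (ψ n)))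
    (hu : Measurable (Function.uncurry u)) (hv : Measurable (Function.uncurry v))
    (eu : rieszEnergy β I u < ∞) (ev : rieszEnergy β I v < ∞)
    (lφ : Tendsto (fun n => rieszEnergy β I (fun r y => φ n r y - u r y)) atTop (𝓝 0))
    (lψ : Tendsto (fun n => rieszEnergy β I (fun r y => ψ n r y - v r y)) atTop (𝓝 0)) :
    Tendsto (fun n => ∫ r in I, ∫ y, ∫ z, φ n r y * ‖y - z‖ ^ (-β) * ψ n r z) atTop
      (𝓝 (rieszForm β I u v)) := by
  have mφ : ∀ n, Measurable (Function.uncurry fun r y => φ n r y - u r y) := fun n =>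
    (hφ n).sub hu
  have mψ : ∀ n, Measurable (Function.uncurry fun r y => ψ n r y - v r y) := fun n =>
    (hψ n).sub hv
  have t1 := tendsto_rieszForm_zero hk hβ mφ mψ lφ ENNReal.zero_ne_top lψ
  have t2 := tendsto_rieszForm_zero hk hβ mφ (fun _ => hv) lφ ev.ne tendsto_const_nhds
  have t3 := tendsto_rieszForm_zero hk hβ mψ (fun _ => hu) lψ eu.ne tendsto_const_nhds
  have t := ((t1.add t2).add t3).add_const (rieszForm β I u v)
  simp only [zero_add] at t
  refine t.congr' ?_
  filter_upwards [lφ.eventually_lt_const (u := 1) (by simp),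
    lψ.eventually_lt_const (u := 1) (by simp)] with n h1 h2
  have h := rieszForm_expand hk hβ (hφ n) (hψ n) hu hv eu ev (h1.trans (by simp))
    (h2.trans (by simp))
  rw [← rieszForm_eq_iterated (hφ n) (hψ n)
    (rieszMutual_lt_top_of_integrable (hφ n) (hψ n) h.1), h.2,
    rieszForm_comm u fun r y => ψ n r y - v r y]

end Bilinear

/-! ### Indicators of space-time boxes. -/

section Boxes

variable {k : ℕ} {β : ℝ} {I : Set ℝ}

/-- The indicator function of `S × A`. -/
def box (S : Set ℝ) (A : Set (Eucl k)) (r : ℝ) (y : Eucl k) : ℝ :=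
  (S ×ˢ A).indicator (fun _ => (1 : ℝ)) (r, y)

/-- `∫_A dy ∫_B dz ‖y - z‖^{-β}`. -/
def rieszPair (β : ℝ) (A B : Set (Eucl k)) : ℝ :=
  ∫ q : Eucl k × Eucl k, (A ×ˢ B).indicator (fun q => ‖q.1 - q.2‖ ^ (-β)) q

theorem measurable_box {S : Set ℝ} {A : Set (Eucl k)} (hS : MeasurableSet S)
    (hA : MeasurableSet A) : Measurable (Function.uncurry (box S A)) :=
  measurable_const.indicator (hS.prod hA)

theorem rieszForm_box {S S' : Set ℝ} (hS : MeasurableSet S) (hS' : MeasurableSet S')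
    (A B : Set (Eucl k)) :
    rieszForm β I (box S A) (box S' B) = volume.real (S ∩ S' ∩ I) * rieszPair β A B := by
  have e : rieszIntegrand β (box S A) (box S' B) = fun p : ℝ × Eucl k × Eucl k =>
      (S ∩ S').indicator (fun _ => (1 : ℝ)) p.1 *
        (A ×ˢ B).indicator (fun q => ‖q.1 - q.2‖ ^ (-β)) p.2 := by
    ext ⟨r, y, z⟩
    classical
    simp only [rieszIntegrand, box, Set.indicator_apply, Set.mem_prod, Set.mem_inter_iff]
    by_cases h1 : r ∈ S <;> by_cases h2 : r ∈ S' <;> by_cases h3 : y ∈ A <;>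
      by_cases h4 : z ∈ B <;> simp [h1, h2, h3, h4]
  rw [rieszForm, e, rieszMeasure, integral_prod_mul, integral_indicator (hS.inter hS'),
    rieszPair]
  congr 1
  rw [setIntegral_const, smul_eq_mul, mul_one, measureReal_restrict_apply (hS.inter hS')]

theorem rieszEnergy_box_le {C : ℝ} (hC : ∀ ρ : ℝ, 0 < ρ → ∀ x y : Eucl k,
      ∫⁻ z in Metric.ball x ρ, ENNReal.ofReal (‖y - z‖ ^ (-β)) ≤
        ENNReal.ofReal (C * ρ ^ ((k : ℝ) - β)))
    {S : Set ℝ} (hS : MeasurableSet S) {A : Set (Eucl k)} {x : Eucl k} {ρ : ℝ} (hρ : 0 < ρ)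
    (hA : A ⊆ Metric.ball x ρ) :
    rieszEnergy β I (box S A) ≤ volume (S ∩ I) *
      (volume (Metric.ball x ρ) * ENNReal.ofReal (C * ρ ^ ((k : ℝ) - β))) := by
  calc
    rieszEnergy β I (box S A) ≤ ∫⁻ r in I, S.indicator (fun _ => ∫⁻ y in Metric.ball x ρ,
        ∫⁻ z in Metric.ball x ρ, ENNReal.ofReal (‖y - z‖ ^ (-β))) r := by
        refine lintegral_mono fun r => ?_
        by_cases hr : r ∈ S
        · rw [Set.indicator_of_mem hr, ← lintegral_indicator measurableSet_ball]
          refine lintegral_mono fun y => ?_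
          by_cases hy : y ∈ A
          · rw [Set.indicator_of_mem (hA hy), ← lintegral_indicator measurableSet_ball]
            refine lintegral_mono fun z => ?_
            by_cases hz : z ∈ A
            · simp [hr, hy, hz, box, hA hz]
            · simp [hz, box]
          · simp [hy, box]
        · simp [hr, box]
    _ ≤ ∫⁻ r in I, S.indicator (fun _ => ∫⁻ y in Metric.ball x ρ,
        ENNReal.ofReal (C * ρ ^ ((k : ℝ) - β))) r := by
        gcongr
        exact hC ρ hρ _ _
    _ = _ := by
        rw [lintegral_indicator hS, setLIntegral_const, setLIntegral_const,
          Measure.restrict_apply hS]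
        ring

theorem rieszEnergy_box_lt_top (hβ0 : 0 < β) (hβk : β < k) {S : Set ℝ} (hS : MeasurableSet S)
    (hSI : volume (S ∩ I) < ∞) {A : Set (Eucl k)} (hA : Bornology.IsBounded A) :
    rieszEnergy β I (box S A) < ∞ := by
  obtain ⟨C, -, hC⟩ := exists_lintegral_ball_rpow_le hβ0 hβk
  obtain ⟨ρ, hρ⟩ := hA.subset_ball (0 : Eucl k)
  have hsub : A ⊆ Metric.ball 0 (max ρ 1) := hρ.trans (Metric.ball_subset_ball (le_max_left _ _))
  refine (rieszEnergy_box_le hC hS (by positivity) hsub).trans_lt ?_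
  exact ENNReal.mul_lt_top hSI (ENNReal.mul_lt_top measure_ball_lt_top ENNReal.ofReal_lt_top)

end Boxes

/-! ### Gaussian structure and covariance of `M`; independence of its increments from the past. -/

section MartingaleMeasure

variable {Ω : Type*} [MeasurableSpace Ω] {P : Measure Ω} {k d : ℕ} {β : ℝ}
  {F : Fin d → SpaceTimeTest k → Ω → ℝ} {M : Fin d → ℝ → Set (Eucl k) → Ω → ℝ}

/-- The admissible indices `(i, t, A)` of a martingale measure. -/
abbrev Cell (k d : ℕ) : Type :=
  {q : Fin d × ℝ × Set (Eucl k) // 0 ≤ q.2.1 ∧ MeasurableSet q.2.2 ∧ Bornology.IsBounded q.2.2}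

/-- The value of `M` at an admissible index. -/
abbrev cellValue (M : Fin d → ℝ → Set (Eucl k) → Ω → ℝ) (q : Cell k d) : Ω → ℝ :=
  M q.1.1 q.1.2.1 q.1.2.2

/-- With one approximating sequence chosen for each cell, the joint Gaussianity of `F` passes to the
limit for all cells simultaneously. -/
theorem isGaussianProcess_cellValue [IsProbabilityMeasure P] (hF : IsRieszNoise P β F) (hM : IsMartingaleMeasureOf P β F M) :
    IsGaussianProcess (cellValue M) P := by
  have h : ∀ q : Cell k d, ∃ φ : ℕ → SpaceTimeTest k, Tendsto (fun n =>
      eLpNorm (fun ω => F q.1.1 (φ n) ω - cellValue M q ω) 2 P) atTop (𝓝 0) := by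
    rintro ⟨⟨i, t, A⟩, h0, hA, hb⟩
    obtain ⟨φ, -, h⟩ := hM.extension i t A h0 hA hb
    exact ⟨φ, h⟩
  let φ : Cell k d → ℕ → SpaceTimeTest k := fun q => (h q).choose
  have hφ : ∀ q, Tendsto (fun n =>
      eLpNorm (fun ω => F q.1.1 (φ q n) ω - cellValue M q ω) 2 P) atTop (𝓝 0) :=
    fun q => (h q).choose_spec
  have hZ : ∀ n, IsGaussianProcess (fun q : Cell k d => F q.1.1 (φ q n)) P := fun n =>
    hF.gaussian.comp_right (fun q : Cell k d => (q.1.1, φ q n))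
  have hm : ∀ q : Cell k d, AEStronglyMeasurable (cellValue M q) P := fun q =>
    (hM.measurable q.1.1 q.1.2.1 q.1.2.2 q.2.1 q.2.2.1 q.2.2.2).aestronglyMeasurable
  exact isGaussianProcess_of_tendsto_eLpNorm hZ hm hφ

theorem measurable_testFunction (φ : SpaceTimeTest k) :
    Measurable (Function.uncurry fun r y => φ (r, y)) :=
  φ.continuous.measurable

theorem volume_real_Icc_inter_Icc_inter_Ioi {s t : ℝ} (hs : 0 ≤ s) (ht : 0 ≤ t) :
    volume.real (Set.Icc 0 s ∩ Set.Icc 0 t ∩ Set.Ioi 0) = min s t := by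
  have : Set.Icc 0 s ∩ Set.Icc 0 t ∩ Set.Ioi 0 = Set.Ioc 0 (min s t) := by
    ext r
    simp only [Set.mem_inter_iff, Set.mem_Icc, Set.mem_Ioi, Set.mem_Ioc, le_min_iff]
    constructor
    · rintro ⟨⟨h1, h2⟩, h3⟩
      exact ⟨h3, h1.2, h2.2⟩
    · rintro ⟨h1, h2, h3⟩
      exact ⟨⟨⟨h1.le, h2⟩, h1.le, h3⟩, h1⟩
  rw [this, Real.volume_real_Ioc_of_le (le_min hs ht), sub_zero]

theorem memLp_cellValue [IsProbabilityMeasure P] (hF : IsRieszNoise P β F) (hM : IsMartingaleMeasureOf P β F M)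
    (i : Fin d) {t : ℝ} (ht : 0 ≤ t) {A : Set (Eucl k)} (hA : MeasurableSet A)
    (hb : Bornology.IsBounded A) : MemLp (M i t A) 2 P :=
  ((isGaussianProcess_cellValue hF hM).hasGaussianLaw_eval
    ⟨(i, t, A), ht, hA, hb⟩).memLp_two

theorem integral_cellValue [IsProbabilityMeasure P] (hF : IsRieszNoise P β F) (hM : IsMartingaleMeasureOf P β F M)
    (i : Fin d) {t : ℝ} (ht : 0 ≤ t) {A : Set (Eucl k)} (hA : MeasurableSet A)
    (hb : Bornology.IsBounded A) : ∫ ω, M i t A ω ∂P = 0 := by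
  obtain ⟨φ, -, h⟩ := hM.extension i t A ht hA hb
  have hone : MemLp (fun _ : Ω => (1 : ℝ)) 2 P := memLp_const 1
  have := tendsto_integral_mul_of_tendsto_eLpNorm
    (fun n => (hF.gaussian.hasGaussianLaw_eval (i, φ n)).memLp_two) (fun _ => hone)
    (memLp_cellValue hF hM i ht hA hb) hone h (by simp)
  simp only [mul_one, hF.mean_zero] at this
  exact tendsto_nhds_unique this tendsto_const_nhds

/-- The covariance of the approximating test functions has two descriptions of its limit: `L²`
convergence of the variables, and energy continuity of the form. -/
theorem integral_cellValue_mul [IsProbabilityMeasure P] (hβ0 : 0 < β) (hβk : β < k) (hF : IsRieszNoise P β F)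
    (hM : IsMartingaleMeasureOf P β F M) (i j : Fin d) {s t : ℝ} (hs : 0 ≤ s) (ht : 0 ≤ t)
    {A B : Set (Eucl k)} (hA : MeasurableSet A) (hb : Bornology.IsBounded A)
    (hB : MeasurableSet B) (hbB : Bornology.IsBounded B) :
    ∫ ω, M i s A ω * M j t B ω ∂P = (if i = j then 1 else 0) * (min s t * rieszPair β A B) := by
  have hk : 0 < k := by
    have : (0 : ℝ) < k := hβ0.trans hβk
    exact_mod_cast this
  obtain ⟨φ, hφ, h1⟩ := hM.extension i s A hs hA hb
  obtain ⟨ψ, hψ, h2⟩ := hM.extension j t B ht hB hbB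
  have l1 := tendsto_integral_mul_of_tendsto_eLpNorm
    (fun n => (hF.gaussian.hasGaussianLaw_eval (i, φ n)).memLp_two)
    (fun n => (hF.gaussian.hasGaussianLaw_eval (j, ψ n)).memLp_two)
    (memLp_cellValue hF hM i hs hA hb) (memLp_cellValue hF hM j ht hB hbB) h1 h2
  simp only [hF.covariance] at l1
  have fin : ∀ t : ℝ, volume (Set.Icc 0 t ∩ Set.Ioi 0) < ∞ := fun t =>
    (measure_mono Set.inter_subset_left).trans_lt measure_Icc_lt_top
  have l2 := tendsto_rieszForm hk hβ0 (fun n => measurable_testFunction (φ n))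
    (fun n => measurable_testFunction (ψ n)) (measurable_box measurableSet_Icc hA)
    (measurable_box measurableSet_Icc hB)
    (rieszEnergy_box_lt_top hβ0 hβk measurableSet_Icc (fin s) hb)
    (rieszEnergy_box_lt_top hβ0 hβk measurableSet_Icc (fin t) hbB) hφ hψ
  rw [rieszForm_box measurableSet_Icc measurableSet_Icc,
    volume_real_Icc_inter_Icc_inter_Ioi hs ht] at l2
  exact tendsto_nhds_unique l1 (l2.const_mul _)

theorem naturalFiltration_le (hM : IsMartingaleMeasureOf P β F M) (t : ℝ) :
    naturalFiltration P M t ≤ ‹MeasurableSpace Ω› := by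
  refine MeasurableSpace.generateFrom_le ?_
  rintro B (⟨i, s, A, h0, -, hA, hb, U, hU, rfl⟩ | ⟨hB, -⟩)
  · exact hM.measurable i s A h0 hA hb hU
  · exact hB

theorem naturalFiltration_mono (M : Fin d → ℝ → Set (Eucl k) → Ω → ℝ) {s t : ℝ} (hst : s ≤ t) :
    naturalFiltration P M s ≤ naturalFiltration P M t := by
  refine MeasurableSpace.generateFrom_mono (Set.union_subset_union_left _ ?_)
  rintro B ⟨i, r, A, h0, hr, h⟩
  exact ⟨i, r, A, h0, hr.trans hst, h⟩

theorem measurable_naturalFiltration (i : Fin d) {s t : ℝ} (hs : 0 ≤ s) (hst : s ≤ t)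
    {A : Set (Eucl k)} (hA : MeasurableSet A) (hb : Bornology.IsBounded A) :
    Measurable[naturalFiltration P M t] (M i s A) := fun U hU =>
  MeasurableSpace.measurableSet_generateFrom (Or.inl ⟨i, s, A, hs, hst, hA, hb, U, hU, rfl⟩)

/-- The increments after time `a`. -/
def increments (M : Fin d → ℝ → Set (Eucl k) → Ω → ℝ) (a : ℝ)
    (q : {q : Cell k d // a ≤ q.1.2.1}) (ω : Ω) : ℝ :=
  M q.1.1.1 q.1.1.2.1 q.1.1.2.2 ω - M q.1.1.1 a q.1.1.2.2 ω

/-- The increments of `M` after time `a` are independent of the (augmented) past at time `a`. -/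
theorem indep_increments [IsProbabilityMeasure P] (hβ0 : 0 < β) (hβk : β < k) (hF : IsRieszNoise P β F)
    (hM : IsMartingaleMeasureOf P β F M) {a : ℝ} (ha : 0 ≤ a) :
    Indep (naturalFiltration P M a)
      (MeasurableSpace.comap (fun ω q => increments M a q ω) MeasurableSpace.pi) P := by
  set past : {q : Cell k d // q.1.2.1 ≤ a} → Ω → ℝ := fun q => cellValue M q.1
  have hG := isGaussianProcess_cellValue hF hM
  have hmeas : ∀ q : Cell k d, Measurable (cellValue M q) := fun q =>
    hM.measurable _ _ _ q.2.1 q.2.2.1 q.2.2.2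
  have hmi : ∀ q, Measurable (increments M a q) := fun q =>
    (hmeas q.1).sub (hM.measurable _ _ _ ha q.1.2.2.1 q.1.2.2.2)
  have hG2 : IsGaussianProcess (Sum.elim past (increments M a)) P := by
    classical
    refine hG.of_isGaussianProcess ?_
    rintro (q | q)
    · refine ⟨{q.1}, ContinuousLinearMap.proj ⟨q.1, by simp⟩, fun ω => ?_⟩
      simp [past]
    · let q' : Cell k d := ⟨(q.1.1.1, a, q.1.1.2.2), ha, q.1.2.2⟩
      refine ⟨{q.1, q'}, ContinuousLinearMap.proj (R := ℝ)
        (φ := fun _ : ({q.1, q'} : Finset (Cell k d)) => ℝ) ⟨q.1, by simp⟩ -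
        ContinuousLinearMap.proj ⟨q', by simp⟩, fun ω => ?_⟩
      simp [increments, q']
  -- In a jointly Gaussian family, independence is vanishing covariance. Here it vanishes because
  -- `min s t - min s a = s - s` when `s ≤ a ≤ t`.
  have hind := hG2.indepFun_of_covariance_eq_zero (fun q => (hmeas q.1).aemeasurable)
    (fun q => (hmi q).aemeasurable) (by
      rintro ⟨⟨⟨i, s, A⟩, hs, hA, hb⟩, hsa⟩ ⟨⟨⟨j, t, B⟩, ht, hB, hbB⟩, hat⟩
      simp only at hs hA hb hsa ht hB hbB hat
      have m1 := memLp_cellValue hF hM i hs hA hb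
      have m2 := memLp_cellValue hF hM j ht hB hbB
      have m3 := memLp_cellValue hF hM j ha hB hbB
      have e : cov[M i s A, M j t B - M j a B; P] = 0 := by
        rw [covariance_eq_sub m1 (m2.sub m3), integral_cellValue hF hM i hs hA hb, zero_mul,
          sub_zero]
        have : ∀ ω, (M i s A * (M j t B - M j a B)) ω =
            M i s A ω * M j t B ω - M i s A ω * M j a B ω := fun ω => by
          simp [mul_sub]
        rw [integral_congr_ae (Eventually.of_forall this),
          integral_sub (by exact m1.integrable_mul m2) (by exact m1.integrable_mul m3),
          integral_cellValue_mul hβ0 hβk hF hM i j hs ht hA hb hB hbB,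
          integral_cellValue_mul hβ0 hβk hF hM i j hs ha hA hb hB hbB,
          min_eq_left hsa, min_eq_left (hsa.trans hat), sub_self]
      exact e)
  -- Every event of the augmented past agrees almost surely with an event of the raw past, so
  -- independence survives the augmentation.
  have hle : naturalFiltration P M a ≤ eventuallyMeasurableSpace
      (MeasurableSpace.comap (fun ω q => past q ω) MeasurableSpace.pi) (ae P) := by
    refine MeasurableSpace.generateFrom_le ?_
    rintro B (⟨i, s, A, h0, hsa, hA, hb, U, hU, rfl⟩ | ⟨hB, h0⟩)
    · refine le_eventuallyMeasurableSpace (s := M i s A ⁻¹' U) ?_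
      exact ⟨(fun g => g ⟨⟨(i, s, A), h0, hA, hb⟩, hsa⟩) ⁻¹' U,
        measurable_pi_apply _ hU, rfl⟩
    · exact ⟨∅, @MeasurableSet.empty _ (_), by simpa [ae_eq_empty] using h0⟩
  rw [Indep_iff]
  intro B D hB hD
  obtain ⟨B', hB', hBB⟩ := hle _ hB
  rw [measure_congr hBB, measure_congr (hBB.inter (ae_eq_refl D))]
  exact (Indep_iff _ _ _).1 hind B' D hB' hD

end MartingaleMeasure

/-! ### Covariances of increments with random past weights. -/

section Isometry

variable {Ω : Type*} {k d : ℕ} {β : ℝ} {M : Fin d → ℝ → Set (Eucl k) → Ω → ℝ}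

theorem rieszPair_comm (A B : Set (Eucl k)) : rieszPair β A B = rieszPair β B A := by
  rw [rieszPair, rieszPair, Measure.volume_eq_prod, ← integral_prod_swap]
  refine integral_congr_ae (Eventually.of_forall fun q => ?_)
  classical
  simp only [Set.indicator_apply, Set.mem_prod, Prod.fst_swap, Prod.snd_swap, and_comm]
  rw [norm_sub_rev]

theorem measurable_increment {a b : ℝ} (hb0 : 0 ≤ b) (hab : a ≤ b) (i : Fin d) {A : Set (Eucl k)}
    (hA : MeasurableSet A) (hb : Bornology.IsBounded A) :
    Measurable[MeasurableSpace.comap (fun ω q => increments M a q ω) MeasurableSpace.pi]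
      (fun ω => M i b A ω - M i a A ω) := by
  let q : {q : Cell k d // a ≤ q.1.2.1} := ⟨⟨(i, b, A), hb0, hA, hb⟩, hab⟩
  exact (measurable_pi_apply (X := fun _ : {q : Cell k d // a ≤ q.1.2.1} => ℝ) q).comp
    (comap_measurable _)

variable [MeasurableSpace Ω] {P : Measure Ω} {F : Fin d → SpaceTimeTest k → Ω → ℝ}

theorem integral_mul_of_past_of_future [IsProbabilityMeasure P] (hβ0 : 0 < β) (hβk : β < k)
    (hF : IsRieszNoise P β F)
    (hM : IsMartingaleMeasureOf P β F M) {a : ℝ} (ha : 0 ≤ a) {X H : Ω → ℝ}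
    (hX : Measurable[naturalFiltration P M a] X)
    (hH : Measurable[MeasurableSpace.comap (fun ω q => increments M a q ω) MeasurableSpace.pi] H)
    (hHm : AEStronglyMeasurable H P) :
    ∫ ω, X ω * H ω ∂P = (∫ ω, X ω ∂P) * ∫ ω, H ω ∂P := by
  have hi : IndepFun X H P :=
    indep_of_indep_of_le_left (indep_of_indep_of_le_right
      (indep_increments hβ0 hβk hF hM ha) hH.comap_le) hX.comap_le
  exact hi.integral_fun_mul_eq_mul_integral
    (hX.mono (naturalFiltration_le hM a) le_rfl).aestronglyMeasurable hHm

theorem integral_increment_mul_increment [IsProbabilityMeasure P] (hβ0 : 0 < β) (hβk : β < k)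
    (hF : IsRieszNoise P β F) (hM : IsMartingaleMeasureOf P β F M) (i j : Fin d)
    {a b b' : ℝ} (ha : 0 ≤ a) (hab : a ≤ b) (hab' : a ≤ b')
    {A B : Set (Eucl k)} (hA : MeasurableSet A) (hb : Bornology.IsBounded A)
    (hB : MeasurableSet B) (hbB : Bornology.IsBounded B) :
    ∫ ω, (M i b A ω - M i a A ω) * (M j b' B ω - M j a B ω) ∂P =
      (if i = j then 1 else 0) * ((min b b' - a) * rieszPair β A B) := by
  have m1 := memLp_cellValue hF hM i (ha.trans hab) hA hb
  have m2 := memLp_cellValue hF hM i ha hA hb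
  have m3 := memLp_cellValue hF hM j (ha.trans hab') hB hbB
  have m4 := memLp_cellValue hF hM j ha hB hbB
  have e : ∀ ω, (M i b A ω - M i a A ω) * (M j b' B ω - M j a B ω) =
      M i b A ω * M j b' B ω - M i b A ω * M j a B ω -
        (M i a A ω * M j b' B ω - M i a A ω * M j a B ω) := fun ω => by ring
  have i1 : Integrable (fun ω => M i b A ω * M j b' B ω) P := m1.integrable_mul m3
  have i2 : Integrable (fun ω => M i b A ω * M j a B ω) P := m1.integrable_mul m4
  have i3 : Integrable (fun ω => M i a A ω * M j b' B ω) P := m2.integrable_mul m3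
  have i4 : Integrable (fun ω => M i a A ω * M j a B ω) P := m2.integrable_mul m4
  rw [integral_congr_ae (Eventually.of_forall e), integral_sub (by exact i1.sub i2)
    (by exact i3.sub i4), integral_sub i1 i2, integral_sub i3 i4,
    integral_cellValue_mul hβ0 hβk hF hM i j (ha.trans hab) (ha.trans hab') hA hb hB hbB,
    integral_cellValue_mul hβ0 hβk hF hM i j (ha.trans hab) ha hA hb hB hbB,
    integral_cellValue_mul hβ0 hβk hF hM i j ha (ha.trans hab') hA hb hB hbB,
    integral_cellValue_mul hβ0 hβk hF hM i j ha ha hA hb hB hbB,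
    min_eq_right hab, min_eq_left hab', min_self]
  ring

/-- Cut the increment over `(a, b]` at the later left endpoint `a'`. What precedes `a'` is
measurable with respect to the past, hence orthogonal to the centered increment after `a'`. What
remains is the overlap `(a', min b b']`, independent of the weights `X X'`. -/
theorem integral_weighted_increments_of_le [IsProbabilityMeasure P] (hβ0 : 0 < β) (hβk : β < k)
    (hF : IsRieszNoise P β F) (hM : IsMartingaleMeasureOf P β F M) (i j : Fin d)
    {a b a' b' : ℝ} (ha : 0 ≤ a) (hab : a ≤ b) (haa : a ≤ a') (hab' : a' ≤ b')
    {A B : Set (Eucl k)} (hA : MeasurableSet A) (hb : Bornology.IsBounded A)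
    (hB : MeasurableSet B) (hbB : Bornology.IsBounded B) {X X' : Ω → ℝ}
    (hX : Measurable[naturalFiltration P M a] X) (hX' : Measurable[naturalFiltration P M a'] X')
    (bX : ∃ C : ℝ, ∀ ω, |X ω| ≤ C) (bX' : ∃ C : ℝ, ∀ ω, |X' ω| ≤ C) :
    ∫ ω, (X ω * (M i b A ω - M i a A ω)) * (X' ω * (M j b' B ω - M j a' B ω)) ∂P =
      (∫ ω, X ω * X' ω ∂P) * ((if i = j then 1 else 0) *
        (volume.real (Set.Ioc a b ∩ Set.Ioc a' b') * rieszPair β A B)) := by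
  have ha' := ha.trans haa
  have hW : Measurable[naturalFiltration P M a'] fun ω => X ω * X' ω :=
    (hX.mono (naturalFiltration_mono M haa) le_rfl).mul hX'
  have hWm := hW.mono (naturalFiltration_le hM a') le_rfl
  obtain ⟨C, hC⟩ := bX
  obtain ⟨C', hC'⟩ := bX'
  have bW : ∀ ω, ‖X ω * X' ω‖ ≤ C * C' := fun ω => by
    rw [norm_mul]
    exact mul_le_mul (hC ω) (hC' ω) (norm_nonneg _) ((abs_nonneg _).trans (hC ω))
  have mD := (memLp_cellValue hF hM j (ha'.trans hab') hB hbB).sub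
    (memLp_cellValue hF hM j ha' hB hbB)
  have past : ∀ r s, 0 ≤ r → 0 ≤ s → r ≤ a' → s ≤ a' →
      ∫ ω, (X ω * X' ω * (M i s A ω - M i r A ω)) * (M j b' B ω - M j a' B ω) ∂P = 0 := by
    intro r s hr hs hra hsa
    have hN : Measurable[naturalFiltration P M a']
        fun ω => X ω * X' ω * (M i s A ω - M i r A ω) :=
      hW.mul ((measurable_naturalFiltration i hs hsa hA hb).sub
        (measurable_naturalFiltration i hr hra hA hb))
    rw [integral_mul_of_past_of_future hβ0 hβk hF hM ha' hN
      (measurable_increment (ha'.trans hab') hab' j hB hbB) mD.1,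
      integral_sub ((memLp_cellValue hF hM j (ha'.trans hab') hB hbB).integrable (by norm_num))
      ((memLp_cellValue hF hM j ha' hB hbB).integrable (by norm_num)),
      integral_cellValue hF hM j (ha'.trans hab') hB hbB, integral_cellValue hF hM j ha' hB hbB]
    simp
  rcases le_total b a' with hba | hba
  · have : Set.Ioc a b ∩ Set.Ioc a' b' = ∅ := by
      ext r
      simp only [Set.mem_inter_iff, Set.mem_Ioc, Set.mem_empty_iff_false, iff_false]
      rintro ⟨h1, h2⟩
      linarith [h1.2, h2.1]
    rw [this, measureReal_empty, zero_mul, mul_zero, mul_zero,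
      ← past a b ha (ha.trans hab) haa hba]
    refine integral_congr_ae (Eventually.of_forall fun ω => ?_)
    simp only
    ring
  · have hov : volume.real (Set.Ioc a b ∩ Set.Ioc a' b') = min b b' - a' := by
      rw [Set.Ioc_inter_Ioc, sup_eq_right.2 haa,
        Real.volume_real_Ioc_of_le (le_inf hba hab')]
    have e : ∀ ω, (X ω * (M i b A ω - M i a A ω)) * (X' ω * (M j b' B ω - M j a' B ω)) =
        (X ω * X' ω * (M i a' A ω - M i a A ω)) * (M j b' B ω - M j a' B ω) +
        (X ω * X' ω) * ((M i b A ω - M i a' A ω) * (M j b' B ω - M j a' B ω)) := fun ω => by ring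
    have mE := (memLp_cellValue hF hM i (ha.trans hab) hA hb).sub
      (memLp_cellValue hF hM i ha' hA hb)
    have mE' := (memLp_cellValue hF hM i ha' hA hb).sub
      (memLp_cellValue hF hM i ha hA hb)
    have i2 : Integrable (fun ω => (X ω * X' ω) *
        ((M i b A ω - M i a' A ω) * (M j b' B ω - M j a' B ω))) P :=
      Integrable.bdd_mul (mE.integrable_mul mD) hWm.aestronglyMeasurable (Eventually.of_forall bW)
    have i1 : Integrable (fun ω => (X ω * X' ω * (M i a' A ω - M i a A ω)) *
        (M j b' B ω - M j a' B ω)) P := by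
      have : Integrable (fun ω => (X ω * X' ω) *
          ((M i a' A ω - M i a A ω) * (M j b' B ω - M j a' B ω))) P :=
        Integrable.bdd_mul (mE'.integrable_mul mD) hWm.aestronglyMeasurable
          (Eventually.of_forall bW)
      simpa only [mul_assoc] using this
    have hH : Measurable[MeasurableSpace.comap (fun ω q => increments M a' q ω)
        MeasurableSpace.pi]
        fun ω => (M i b A ω - M i a' A ω) * (M j b' B ω - M j a' B ω) :=
      (measurable_increment (ha'.trans hba) hba i hA hb).mul
        (measurable_increment (ha'.trans hab') hab' j hB hbB)
    rw [integral_congr_ae (Eventually.of_forall e), integral_add i1 i2,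
      past a a' ha ha' haa le_rfl, zero_add,
      integral_mul_of_past_of_future hβ0 hβk hF hM ha' hW hH (mE.1.mul mD.1),
      integral_increment_mul_increment hβ0 hβk hF hM i j ha' hba hab' hA hb hB hbB, hov]

theorem integral_weighted_increments [IsProbabilityMeasure P] (hβ0 : 0 < β) (hβk : β < k)
    (hF : IsRieszNoise P β F) (hM : IsMartingaleMeasureOf P β F M) (i j : Fin d)
    {a b a' b' : ℝ} (ha : 0 ≤ a) (hab : a ≤ b) (ha' : 0 ≤ a') (hab' : a' ≤ b')
    {A B : Set (Eucl k)} (hA : MeasurableSet A) (hb : Bornology.IsBounded A)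
    (hB : MeasurableSet B) (hbB : Bornology.IsBounded B) {X X' : Ω → ℝ}
    (hX : Measurable[naturalFiltration P M a] X) (hX' : Measurable[naturalFiltration P M a'] X')
    (bX : ∃ C : ℝ, ∀ ω, |X ω| ≤ C) (bX' : ∃ C : ℝ, ∀ ω, |X' ω| ≤ C) :
    ∫ ω, (X ω * (M i b A ω - M i a A ω)) * (X' ω * (M j b' B ω - M j a' B ω)) ∂P =
      (∫ ω, X ω * X' ω ∂P) * ((if i = j then 1 else 0) *
        (volume.real (Set.Ioc a b ∩ Set.Ioc a' b') * rieszPair β A B)) := by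
  rcases le_total a a' with h | h
  · exact integral_weighted_increments_of_le hβ0 hβk hF hM i j ha hab h hab' hA hb hB hbB hX hX'
      bX bX'
  · have := integral_weighted_increments_of_le hβ0 hβk hF hM j i ha' hab' h hab hB hbB hA hb hX' hX
      bX' bX
    rw [rieszPair_comm, Set.inter_comm, if_congr (eq_comm (a := i)) rfl rfl]
    simp only [mul_comm (X _) (X' _), mul_comm (X _ * _) (X' _ * _)]
    exact this

end Isometry

/-! ### The Riesz form of simple processes, for fixed `ω`. -/

section SimpleProcesses

variable {k : ℕ} {β : ℝ} {I : Set ℝ}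

theorem rieszForm_sum_left {ι : Type*} (s : Finset ι) (c : ι → ℝ) (u : ι → ℝ → Eucl k → ℝ)
    (w : ℝ → Eucl k → ℝ)
    (h : ∀ n ∈ s, Integrable (rieszIntegrand β (u n) w) (rieszMeasure k I)) :
    rieszForm β I (fun r y => ∑ n ∈ s, c n * u n r y) w =
      ∑ n ∈ s, c n * rieszForm β I (u n) w := by
  simp only [rieszForm, ← integral_const_mul]
  rw [← integral_finsetSum _ fun n hn => (h n hn).const_mul (c n)]
  refine integral_congr_ae (Eventually.of_forall fun p => ?_)
  simp only [rieszIntegrand, Finset.sum_mul]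
  exact Finset.sum_congr rfl fun n _ => by ring

theorem integrable_rieszIntegrand_sum_left {ι : Type*} (s : Finset ι) (c : ι → ℝ)
    (u : ι → ℝ → Eucl k → ℝ) (w : ℝ → Eucl k → ℝ)
    (h : ∀ n ∈ s, Integrable (rieszIntegrand β (u n) w) (rieszMeasure k I)) :
    Integrable (rieszIntegrand β (fun r y => ∑ n ∈ s, c n * u n r y) w) (rieszMeasure k I) := by
  have := integrable_finsetSum s fun n hn => (h n hn).const_mul (c n)
  refine this.congr (Eventually.of_forall fun p => ?_)
  simp only [rieszIntegrand, Finset.sum_mul]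
  exact Finset.sum_congr rfl fun n _ => by ring

variable {Ω : Type*} {ℱ : ℝ → MeasurableSpace Ω}

/-- The space-time indicator underlying an elementary process. -/
def ElementaryProcess.shape (e : ElementaryProcess k ℱ) : ℝ → Eucl k → ℝ :=
  box (Set.Ioc e.a e.b) e.A

theorem ElementaryProcess.measurable_shape (e : ElementaryProcess k ℱ) :
    Measurable (Function.uncurry e.shape) :=
  measurable_box measurableSet_Ioc e.measurableSet

theorem ElementaryProcess.rieszEnergy_shape_lt_top (hβ0 : 0 < β) (hβk : β < k)
    (e : ElementaryProcess k ℱ) : rieszEnergy β I e.shape < ∞ :=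
  rieszEnergy_box_lt_top hβ0 hβk measurableSet_Ioc
    ((measure_mono Set.inter_subset_left).trans_lt measure_Ioc_lt_top) e.isBounded

theorem SimpleProcess.eval_eq_sum (f : SimpleProcess k ℱ) (ω : Ω) :
    (fun s y => f.eval s y ω) =
      fun s y => ∑ n : Fin f.length, (f.get n).X ω * (f.get n).shape s y := by
  ext s y
  rw [SimpleProcess.eval, ← Fin.sum_univ_fun_getElem]
  rfl

theorem SimpleProcess.integral_eq_sum (f : SimpleProcess k ℱ) (m : ℝ → Set (Eucl k) → Ω → ℝ)
    (t : ℝ) (ω : Ω) :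
    f.integral m t ω = ∑ n : Fin f.length, (f.get n).integral m t ω := by
  rw [SimpleProcess.integral, ← Fin.sum_univ_fun_getElem]
  rfl

theorem SimpleProcess.measurable_eval (f : SimpleProcess k ℱ) (ω : Ω) :
    Measurable (Function.uncurry fun s y => f.eval s y ω) := by
  rw [f.eval_eq_sum ω]
  exact Finset.measurable_sum _ fun n _ => ((f.get n).measurable_shape).const_mul _

theorem SimpleProcess.integrable_rieszIntegrand_eval (hβ0 : 0 < β) (hβk : β < k)
    (f : SimpleProcess k ℱ) (ω : Ω) {w : ℝ → Eucl k → ℝ} (hw : Measurable (Function.uncurry w))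
    (ew : rieszEnergy β I w < ∞) :
    Integrable (rieszIntegrand β (fun s y => f.eval s y ω) w) (rieszMeasure k I) := by
  have hk : 0 < k := by
    have : (0 : ℝ) < k := hβ0.trans hβk
    exact_mod_cast this
  rw [f.eval_eq_sum ω]
  exact integrable_rieszIntegrand_sum_left _ _ _ _ fun n _ =>
    integrable_rieszIntegrand (f.get n).measurable_shape hw (rieszMutual_lt_top hk hβ0
      (f.get n).measurable_shape hw ((f.get n).rieszEnergy_shape_lt_top hβ0 hβk) ew)

theorem SimpleProcess.rieszForm_eval_left (hβ0 : 0 < β) (hβk : β < k)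
    (f : SimpleProcess k ℱ) (ω : Ω) {w : ℝ → Eucl k → ℝ} (hw : Measurable (Function.uncurry w))
    (ew : rieszEnergy β I w < ∞) :
    rieszForm β I (fun s y => f.eval s y ω) w =
      ∑ n : Fin f.length, (f.get n).X ω * rieszForm β I (f.get n).shape w := by
  have hk : 0 < k := by
    have : (0 : ℝ) < k := hβ0.trans hβk
    exact_mod_cast this
  rw [f.eval_eq_sum ω]
  exact rieszForm_sum_left _ _ _ _ fun n _ =>
    integrable_rieszIntegrand (f.get n).measurable_shape hw (rieszMutual_lt_top hk hβ0
      (f.get n).measurable_shape hw ((f.get n).rieszEnergy_shape_lt_top hβ0 hβk) ew)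

theorem SimpleProcess.rieszEnergy_eval_lt_top (hβ0 : 0 < β) (hβk : β < k)
    (f : SimpleProcess k ℱ) (ω : Ω) : rieszEnergy β I (fun s y => f.eval s y ω) < ∞ := by
  have hk : 0 < k := by
    have : (0 : ℝ) < k := hβ0.trans hβk
    exact_mod_cast this
  refine rieszMutual_lt_top_of_integrable (f.measurable_eval ω) (f.measurable_eval ω) ?_
  rw [f.eval_eq_sum ω]
  have h := integrable_finsetSum Finset.univ fun (n : Fin f.length) _ =>
    integrable_finsetSum Finset.univ fun (m : Fin f.length) _ =>
      (integrable_rieszIntegrand (f.get n).measurable_shape (f.get m).measurable_shape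
        (rieszMutual_lt_top (I := I) hk hβ0 (f.get n).measurable_shape (f.get m).measurable_shape
          ((f.get n).rieszEnergy_shape_lt_top hβ0 hβk)
          ((f.get m).rieszEnergy_shape_lt_top hβ0 hβk))).const_mul ((f.get n).X ω * (f.get m).X ω)
  refine h.congr (Eventually.of_forall fun p => ?_)
  simp only [rieszIntegrand, Finset.sum_mul, Finset.mul_sum]
  rw [Finset.sum_comm]
  exact Finset.sum_congr rfl fun n _ => Finset.sum_congr rfl fun m _ => by ring

theorem SimpleProcess.rieszForm_eval_eval (hβ0 : 0 < β) (hβk : β < k)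
    (f : SimpleProcess k ℱ) (ω : Ω) :
    rieszForm β I (fun s y => f.eval s y ω) (fun s y => f.eval s y ω) =
      ∑ n : Fin f.length, ∑ m : Fin f.length, (f.get n).X ω * (f.get m).X ω *
        rieszForm β I (f.get n).shape (f.get m).shape := by
  rw [f.rieszForm_eval_left hβ0 hβk ω (f.measurable_eval ω)
    (f.rieszEnergy_eval_lt_top hβ0 hβk ω)]
  refine Finset.sum_congr rfl fun n _ => ?_
  rw [rieszForm_comm, f.rieszForm_eval_left hβ0 hβk ω (f.get n).measurable_shape
    ((f.get n).rieszEnergy_shape_lt_top hβ0 hβk), Finset.mul_sum]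
  refine Finset.sum_congr rfl fun m _ => ?_
  rw [rieszForm_comm]
  ring

end SimpleProcesses

/-! ### Walsh isometry for simple processes. -/

section SimpleIntegrals

variable {Ω : Type*} [MeasurableSpace Ω] {P : Measure Ω} {k d : ℕ} {β : ℝ}
  {F : Fin d → SpaceTimeTest k → Ω → ℝ} {M : Fin d → ℝ → Set (Eucl k) → Ω → ℝ}

theorem ElementaryProcess.measurable_X (hM : IsMartingaleMeasureOf P β F M)
    (e : ElementaryProcess k (naturalFiltration P M)) : Measurable e.X :=
  e.measurable.mono (naturalFiltration_le hM e.a) le_rfl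

theorem ElementaryProcess.integrable_X_mul [IsProbabilityMeasure P]
    (hM : IsMartingaleMeasureOf P β F M)
    (e e' : ElementaryProcess k (naturalFiltration P M)) :
    Integrable (fun ω => e.X ω * e'.X ω) P := by
  obtain ⟨C, hC⟩ := e.bounded
  obtain ⟨C', hC'⟩ := e'.bounded
  refine Integrable.of_bound ((e.measurable_X hM).mul (e'.measurable_X hM)).aestronglyMeasurable
    (C * C') (Eventually.of_forall fun ω => ?_)
  rw [norm_mul]
  exact mul_le_mul (hC ω) (hC' ω) (norm_nonneg _) ((abs_nonneg _).trans (hC ω))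

theorem ElementaryProcess.integrable_X [IsProbabilityMeasure P]
    (hM : IsMartingaleMeasureOf P β F M)
    (e : ElementaryProcess k (naturalFiltration P M)) : Integrable e.X P := by
  obtain ⟨C, hC⟩ := e.bounded
  exact Integrable.of_bound (e.measurable_X hM).aestronglyMeasurable C (Eventually.of_forall hC)

theorem ElementaryProcess.memLp_integral [IsProbabilityMeasure P] (hF : IsRieszNoise P β F)
    (hM : IsMartingaleMeasureOf P β F M) (e : ElementaryProcess k (naturalFiltration P M))
    (i : Fin d) {t : ℝ} (ht : 0 ≤ t) : MemLp (e.integral (M i) t) 2 P := by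
  obtain ⟨C, hC⟩ := e.bounded
  have hX : MemLp e.X ∞ P :=
    memLp_top_of_bound (e.measurable_X hM).aestronglyMeasurable C (Eventually.of_forall hC)
  have h1 := memLp_cellValue hF hM i (le_min ht (e.nonneg.trans e.lt.le)) e.measurableSet e.isBounded
  have h2 := memLp_cellValue hF hM i (le_min ht e.nonneg) e.measurableSet e.isBounded
  exact (h1.sub h2).mul hX

/-- Stopping at `t` replaces `(a, b]` by `(a, min t b]`, which reduces to weighted increments. If `t
≤ a`, both endpoints collapse to `t` and everything vanishes. -/
theorem ElementaryProcess.integral_mul [IsProbabilityMeasure P] (hβ0 : 0 < β) (hβk : β < k)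
    (hF : IsRieszNoise P β F) (hM : IsMartingaleMeasureOf P β F M)
    (e e' : ElementaryProcess k (naturalFiltration P M)) (i j : Fin d) (t t' : ℝ) :
    ∫ ω, e.integral (M i) t ω * e'.integral (M j) t' ω ∂P =
      (∫ ω, e.X ω * e'.X ω ∂P) * ((if i = j then 1 else 0) *
        (volume.real (Set.Ioc e.a e.b ∩ Set.Ioc 0 t ∩ (Set.Ioc e'.a e'.b ∩ Set.Ioc 0 t')) *
          rieszPair β e.A e'.A)) := by
  have key : ∀ (e : ElementaryProcess k (naturalFiltration P M)) {t : ℝ}, e.a ≤ t →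
      Set.Ioc e.a e.b ∩ Set.Ioc 0 t = Set.Ioc e.a (min t e.b) := by
    intro e t h
    rw [Set.Ioc_inter_Ioc, sup_eq_left.2 e.nonneg, min_comm]
  have key2 : ∀ (e : ElementaryProcess k (naturalFiltration P M)) {t : ℝ}, t ≤ e.a →
      Set.Ioc e.a e.b ∩ Set.Ioc 0 t = ∅ := by
    intro e t h
    rw [Set.Ioc_inter_Ioc, Set.Ioc_eq_empty]
    exact not_lt.2 ((inf_le_right.trans h).trans le_sup_left)
  rcases le_total t e.a with h | h
  · rw [key2 e h]
    simp [ElementaryProcess.integral, min_eq_left h, min_eq_left (h.trans e.lt.le)]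
  rcases le_total t' e'.a with h' | h'
  · rw [key2 e' h']
    simp [ElementaryProcess.integral, min_eq_left h', min_eq_left (h'.trans e'.lt.le)]
  rw [key e h, key e' h']
  simp only [ElementaryProcess.integral, min_eq_right h, min_eq_right h']
  exact integral_weighted_increments hβ0 hβk hF hM i j e.nonneg (le_min h e.lt.le) e'.nonneg
    (le_min h' e'.lt.le) e.measurableSet e.isBounded e'.measurableSet e'.isBounded e.measurable
    e'.measurable e.bounded e'.bounded

theorem SimpleProcess.memLp_integral [IsProbabilityMeasure P] (hF : IsRieszNoise P β F)
    (hM : IsMartingaleMeasureOf P β F M) (f : SimpleProcess k (naturalFiltration P M))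
    (i : Fin d) {t : ℝ} (ht : 0 ≤ t) : MemLp (f.integral (M i) t) 2 P := by
  have : f.integral (M i) t = fun ω => ∑ n : Fin f.length, (f.get n).integral (M i) t ω := by
    ext ω
    exact f.integral_eq_sum (M i) t ω
  rw [this]
  exact memLp_finsetSum _ fun n _ => (f.get n).memLp_integral hF hM i ht

/-- The Walsh isometry for simple processes. -/
theorem SimpleProcess.integral_mul_self [IsProbabilityMeasure P] (hβ0 : 0 < β) (hβk : β < k)
    (hF : IsRieszNoise P β F) (hM : IsMartingaleMeasureOf P β F M)
    (f : SimpleProcess k (naturalFiltration P M)) (i : Fin d) {t : ℝ} (ht : 0 ≤ t) :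
    ∫ ω, f.integral (M i) t ω * f.integral (M i) t ω ∂P =
      ∫ ω, rieszForm β (Set.Ioc 0 t) (fun s y => f.eval s y ω) (fun s y => f.eval s y ω) ∂P := by
  simp only [f.rieszForm_eval_eval hβ0 hβk, f.integral_eq_sum, Finset.sum_mul_sum]
  rw [integral_finsetSum, integral_finsetSum]
  · refine Finset.sum_congr rfl fun n _ => ?_
    rw [integral_finsetSum, integral_finsetSum]
    · refine Finset.sum_congr rfl fun m _ => ?_
      rw [ElementaryProcess.integral_mul hβ0 hβk hF hM _ _ i i t t, integral_mul_const]
      congr 1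
      rw [if_pos rfl, one_mul, ElementaryProcess.shape, ElementaryProcess.shape,
        rieszForm_box measurableSet_Ioc measurableSet_Ioc, ← Set.inter_inter_distrib_right]
    · exact fun m _ => ((f.get n).integrable_X_mul hM (f.get m)).mul_const _
    · exact fun m _ => ((f.get n).memLp_integral hF hM i ht).integrable_mul
        ((f.get m).memLp_integral hF hM i ht)
  · exact fun n _ => integrable_finsetSum _ fun m _ =>
      ((f.get n).integrable_X_mul hM (f.get m)).mul_const _
  · exact fun n _ => integrable_finsetSum _ fun m _ =>
      ((f.get n).memLp_integral hF hM i ht).integrable_mul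
        ((f.get m).memLp_integral hF hM i ht)

theorem SimpleProcess.integral_mul_increment [IsProbabilityMeasure P] (hβ0 : 0 < β) (hβk : β < k)
    (hF : IsRieszNoise P β F) (hM : IsMartingaleMeasureOf P β F M)
    (f : SimpleProcess k (naturalFiltration P M)) (i j : Fin d) {t : ℝ} (ht : 0 ≤ t)
    {a b : ℝ} (ha : 0 ≤ a) (hab : a < b) {B : Set (Eucl k)} (hB : MeasurableSet B)
    (hbB : Bornology.IsBounded B) :
    ∫ ω, f.integral (M i) t ω * (M j b B ω - M j a B ω) ∂P = (if i = j then 1 else 0) *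
      ∫ ω, rieszForm β (Set.Ioc 0 t) (fun s y => f.eval s y ω) (box (Set.Ioc a b) B) ∂P := by
  -- The increment of `M` is itself an elementary integral, with weight `1`, evaluated at its final
  -- time `b`.
  let e : ElementaryProcess k (naturalFiltration P M) :=
    { a := a, b := b, A := B, X := fun _ => 1, nonneg := ha, lt := hab, measurableSet := hB,
      isBounded := hbB, measurable := measurable_const, bounded := ⟨1, fun _ => by simp⟩ }
  have he : ∀ ω, M j b B ω - M j a B ω = e.integral (M j) b ω := fun ω => by
    simp [ElementaryProcess.integral, e, min_eq_right hab.le]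
  have hb : 0 ≤ b := ha.trans hab.le
  simp only [f.integral_eq_sum, he, Finset.sum_mul]
  have hsh : ∀ ω, rieszForm β (Set.Ioc 0 t) (fun s y => f.eval s y ω) (box (Set.Ioc a b) B) =
      ∑ n : Fin f.length, (f.get n).X ω * rieszForm β (Set.Ioc 0 t) (f.get n).shape e.shape :=
    fun ω => f.rieszForm_eval_left hβ0 hβk ω e.measurable_shape
      (e.rieszEnergy_shape_lt_top hβ0 hβk)
  simp only [hsh]
  rw [integral_finsetSum, integral_finsetSum, Finset.mul_sum]
  · refine Finset.sum_congr rfl fun n _ => ?_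
    rw [ElementaryProcess.integral_mul hβ0 hβk hF hM _ _ i j t b,
      show ∫ ω, (f.get n).X ω * e.X ω ∂P = ∫ ω, (f.get n).X ω ∂P by simp [e], integral_mul_const,
      ElementaryProcess.shape, ElementaryProcess.shape,
      rieszForm_box measurableSet_Ioc measurableSet_Ioc]
    have h1 : Set.Ioc e.a e.b ∩ Set.Ioc 0 b = Set.Ioc e.a e.b :=
      Set.inter_eq_left.2 (Set.Ioc_subset_Ioc_left ha)
    rw [h1, Set.inter_right_comm]
    ring
  · exact fun n _ => ((f.get n).integrable_X hM).mul_const _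
  · exact fun n _ => ((f.get n).memLp_integral hF hM i ht).integrable_mul
      (e.memLp_integral hF hM j hb)

end SimpleIntegrals

/-! ### Quasi-triangle inequality for the energy. -/

section EnergyAdd

variable {k : ℕ} {β : ℝ} {I : Set ℝ} {u v : ℝ → Eucl k → ℝ}

theorem rpow_half_mul_rpow_half_le (a b : ℝ≥0∞) : a ^ (1 / 2 : ℝ) * b ^ (1 / 2 : ℝ) ≤ a + b := by
  wlog h : a ≤ b with H
  · rw [mul_comm, add_comm]
    exact H b a (le_of_not_ge h)
  calc
    a ^ (1 / 2 : ℝ) * b ^ (1 / 2 : ℝ) ≤ b ^ (1 / 2 : ℝ) * b ^ (1 / 2 : ℝ) := by gcongr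
    _ = b := by
      rw [← ENNReal.rpow_add_of_nonneg _ _ (by norm_num) (by norm_num)]
      norm_num
    _ ≤ a + b := le_add_self

/-- Of the four terms of the expansion, each of the two cross terms is at most the sum of the
energies, by Cauchy–Schwarz and `√(ab) ≤ a + b`; hence the constant `3`. -/
theorem rieszEnergy_add_le (hk : 0 < k) (hβ : 0 < β) (hu : Measurable (Function.uncurry u))
    (hv : Measurable (Function.uncurry v)) :
    rieszEnergy β I (fun r y => u r y + v r y) ≤ 3 * (rieszEnergy β I u + rieszEnergy β I v) := by
  have m1 := (measurable_rieszIntegrand (β := β) hu hu).enorm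
  have m2 := (measurable_rieszIntegrand (β := β) hu hv).enorm
  have m3 := (measurable_rieszIntegrand (β := β) hv hu).enorm
  have m4 := (measurable_rieszIntegrand (β := β) hv hv).enorm
  have hadd : Measurable (Function.uncurry fun r y => u r y + v r y) := hu.add hv
  have huv : rieszMutual β I u v ≤ rieszEnergy β I u + rieszEnergy β I v :=
    (rieszMutual_le hk hβ hu hv).trans (rpow_half_mul_rpow_half_le _ _)
  have hvu : rieszMutual β I v u ≤ rieszEnergy β I u + rieszEnergy β I v := by
    rw [add_comm]
    exact (rieszMutual_le hk hβ hv hu).trans (rpow_half_mul_rpow_half_le _ _)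
  calc
    rieszEnergy β I (fun r y => u r y + v r y)
      = ∫⁻ p, ‖rieszIntegrand β (fun r y => u r y + v r y) (fun r y => u r y + v r y) p‖ₑ
          ∂(rieszMeasure k I) := rieszMutual_eq_lintegral hadd hadd
    _ ≤ ∫⁻ p, (‖rieszIntegrand β u u p‖ₑ + ‖rieszIntegrand β u v p‖ₑ +
          ‖rieszIntegrand β v u p‖ₑ + ‖rieszIntegrand β v v p‖ₑ) ∂(rieszMeasure k I) := by
        refine lintegral_mono fun p => ?_
        have : rieszIntegrand β (fun r y => u r y + v r y) (fun r y => u r y + v r y) p =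
            rieszIntegrand β u u p + rieszIntegrand β u v p + rieszIntegrand β v u p +
              rieszIntegrand β v v p := by
          simp only [rieszIntegrand]
          ring
        rw [this]
        refine (enorm_add_le _ _).trans (add_le_add_left ?_ _)
        refine (enorm_add_le _ _).trans (add_le_add_left ?_ _)
        exact enorm_add_le _ _
    _ = rieszMutual β I u u + rieszMutual β I u v + rieszMutual β I v u +
          rieszMutual β I v v := by
        rw [lintegral_add_right _ m4, lintegral_add_right _ m3, lintegral_add_right _ m2,
          rieszMutual_eq_lintegral hu hu, rieszMutual_eq_lintegral hu hv,
          rieszMutual_eq_lintegral hv hu, rieszMutual_eq_lintegral hv hv]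
    _ ≤ rieszEnergy β I u + (rieszEnergy β I u + rieszEnergy β I v) +
          (rieszEnergy β I u + rieszEnergy β I v) + rieszEnergy β I v :=
        add_le_add (add_le_add (add_le_add le_rfl huv) hvu) le_rfl
    _ = _ := by ring

theorem rieszEnergy_neg : rieszEnergy β I (fun r y => -u r y) = rieszEnergy β I u := by
  simp only [rieszEnergy, abs_neg]

end EnergyAdd

/-! ### Walsh integrals of deterministic functions: Gaussian law and duality. -/

section Walsh

variable {Ω : Type*} [MeasurableSpace Ω] {P : Measure Ω} {k d : ℕ} {β : ℝ}
  {F : Fin d → SpaceTimeTest k → Ω → ℝ} {M : Fin d → ℝ → Set (Eucl k) → Ω → ℝ}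

/-- This selects a good sample point. The function is not assumed measurable, so the slack `ε`
stands in for a pointwise bound by the lower integral itself. -/
theorem exists_le_lintegral_add [IsProbabilityMeasure P] (f : Ω → ℝ≥0∞) {ε : ℝ≥0∞} (hε : ε ≠ 0) :
    ∃ ω, f ω ≤ ∫⁻ ω, f ω ∂P + ε := by
  by_contra! h
  have hle : ∫⁻ ω, f ω ∂P + ε ≤ ∫⁻ ω, f ω ∂P := by
    calc
      _ = ∫⁻ _ : Ω, (∫⁻ ω, f ω ∂P + ε) ∂P := by simp
      _ ≤ _ := lintegral_mono fun ω => (h ω).le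
  have hne : ∫⁻ ω, f ω ∂P ≠ ∞ := by
    intro htop
    obtain ⟨ω⟩ : Nonempty Ω := nonempty_of_isProbabilityMeasure P
    have := h ω
    rw [htop] at this
    simp at this
  exact hle.not_gt (ENNReal.lt_add_right hne hε)

/-- The isometry involves the signed form, which the energy dominates; the resulting inequality is
the continuity needed for limits. -/
theorem SimpleProcess.eLpNorm_integral_le [IsProbabilityMeasure P] (hβ0 : 0 < β) (hβk : β < k)
    (hF : IsRieszNoise P β F) (hM : IsMartingaleMeasureOf P β F M)
    (f : SimpleProcess k (naturalFiltration P M)) (i : Fin d) {t : ℝ} (ht : 0 ≤ t) :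
    eLpNorm (f.integral (M i) t) 2 P ≤
      (∫⁻ ω, rieszEnergy β (Set.Ioc 0 t) (fun s y => f.eval s y ω) ∂P) ^ (1 / 2 : ℝ) := by
  rw [eLpNorm_eq_lintegral_rpow_enorm_toReal (by norm_num) (by norm_num)]
  have hm := f.memLp_integral hF hM i ht
  simp only [ENNReal.toReal_ofNat, ENNReal.rpow_two]
  refine ENNReal.rpow_le_rpow ?_ (by norm_num)
  have e : ∫⁻ ω, ‖f.integral (M i) t ω‖ₑ ^ 2 ∂P =
      ENNReal.ofReal (∫ ω, f.integral (M i) t ω * f.integral (M i) t ω ∂P) := by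
    rw [ofReal_integral_eq_lintegral_ofReal (by exact hm.integrable_mul hm)
      (Eventually.of_forall fun ω => mul_self_nonneg _)]
    refine lintegral_congr fun ω => ?_
    rw [← ofReal_norm, ← ENNReal.ofReal_pow (norm_nonneg _), Real.norm_eq_abs, sq_abs, pow_two]
  rw [e, f.integral_mul_self hβ0 hβk hF hM i ht]
  calc
    _ ≤ ‖∫ ω, rieszForm β (Set.Ioc 0 t) (fun s y => f.eval s y ω)
          (fun s y => f.eval s y ω) ∂P‖ₑ := by
        rw [← ofReal_norm]
        exact ENNReal.ofReal_le_ofReal (le_abs_self _)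
    _ ≤ ∫⁻ ω, ‖rieszForm β (Set.Ioc 0 t) (fun s y => f.eval s y ω)
          (fun s y => f.eval s y ω)‖ₑ ∂P := enorm_integral_le_lintegral_enorm _
    _ ≤ _ := lintegral_mono fun ω => enorm_rieszForm_le (f.measurable_eval ω) (f.measurable_eval ω)

/-- The elementary process with the same shape and a deterministic weight. -/
def ElementaryProcess.withWeight {ℱ : ℝ → MeasurableSpace Ω} (e : ElementaryProcess k ℱ) (c : ℝ) :
    ElementaryProcess k ℱ :=
  { e with
    X := fun _ => c
    measurable := measurable_const
    bounded := ⟨|c|, fun _ => le_rfl⟩ }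

theorem hasGaussianLaw_frozen_integral [IsProbabilityMeasure P] (hF : IsRieszNoise P β F)
    (hM : IsMartingaleMeasureOf P β F M) (f : SimpleProcess k (naturalFiltration P M)) (i : Fin d)
    {t : ℝ} (ht : 0 ≤ t) (c : Fin f.length → ℝ) :
    HasGaussianLaw (fun ω => ∑ n : Fin f.length, ((f.get n).withWeight (c n)).integral (M i) t ω)
      P := by
  have hG := isGaussianProcess_cellValue hF hM
  have : IsGaussianProcess (fun n : Fin f.length => ((f.get n).withWeight (c n)).integral (M i) t)
      P := by
    classical
    refine hG.of_isGaussianProcess fun n => ?_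
    let q : Cell k d := ⟨(i, min t (f.get n).b, (f.get n).A),
      le_min ht ((f.get n).nonneg.trans (f.get n).lt.le), (f.get n).measurableSet,
      (f.get n).isBounded⟩
    let q' : Cell k d := ⟨(i, min t (f.get n).a, (f.get n).A),
      le_min ht (f.get n).nonneg, (f.get n).measurableSet, (f.get n).isBounded⟩
    refine ⟨{q, q'}, c n • (ContinuousLinearMap.proj (R := ℝ)
        (φ := fun _ : ({q, q'} : Finset (Cell k d)) => ℝ) ⟨q, by simp⟩ -
        ContinuousLinearMap.proj ⟨q', by simp⟩), fun ω => ?_⟩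
    simp [ElementaryProcess.integral, ElementaryProcess.withWeight, q, q']
  exact this.hasGaussianLaw_fun_sum (I := Finset.univ)

/-- The Walsh integral of a deterministic function is Gaussian. -/
theorem IsWalshIntegral.hasGaussianLaw [IsProbabilityMeasure P] (hβ0 : 0 < β) (hβk : β < k)
    (hF : IsRieszNoise P β F) (hM : IsMartingaleMeasureOf P β F M) {i : Fin d} {t : ℝ} (ht : 0 ≤ t)
    {g : ℝ → Eucl k → ℝ} (hg : Measurable (Function.uncurry g)) {Y : Ω → ℝ}
    (hY : IsWalshIntegral P β (naturalFiltration P M) (M i) t (fun s y _ => g s y) Y) :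
    HasGaussianLaw Y P := by
  have hk : 0 < k := by
    have : (0 : ℝ) < k := hβ0.trans hβk
    exact_mod_cast this
  obtain ⟨hY2, f, hf, hfY⟩ := hY
  set L : ℕ → ℝ≥0∞ := fun n => ∫⁻ ω, rieszEnergy β (Set.Ioc 0 t)
      (fun s y => g s y - (f n).eval s y ω) ∂P with hL
  have hω : ∀ n : ℕ, ∃ ω, rieszEnergy β (Set.Ioc 0 t) (fun s y => g s y - (f n).eval s y ω) ≤
      L n + ((n : ℝ≥0∞) + 1)⁻¹ := fun n =>
    exists_le_lintegral_add _ (by simp)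
  -- As `g` is deterministic, the random weights of `f n` may be frozen at a sample point `w n`
  -- where `f n` is almost as close to `g` as on average. The frozen process has constant weights,
  -- so its integral `Z n` is Gaussian.
  choose w hw using hω
  -- The difference of `f n` and its frozen version, as a single simple process: concatenation with
  -- negated constant weights. Both are close to `g`, so its energy tends to `0`.
  let D : ℕ → SimpleProcess k (naturalFiltration P M) := fun n =>
    f n ++ (f n).map fun e => e.withWeight (-e.X (w n))
  let Z : ℕ → Ω → ℝ := fun n ω =>
    ∑ m : Fin (f n).length, (((f n).get m).withWeight (((f n).get m).X (w n))).integral (M i) t ω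
  have hDint : ∀ n ω, (D n).integral (M i) t ω = (f n).integral (M i) t ω - Z n ω := by
    intro n ω
    have h2 : (((f n).map fun e => e.withWeight (-e.X (w n))).map
        fun e => e.integral (M i) t ω).sum = -Z n ω := by
      rw [List.map_map, ← Fin.sum_univ_fun_getElem, ← Finset.sum_neg_distrib]
      refine Finset.sum_congr rfl fun m _ => ?_
      simp [ElementaryProcess.integral, ElementaryProcess.withWeight]
    rw [SimpleProcess.integral, List.map_append, List.sum_append, h2, ← sub_eq_add_neg]
    rfl
  have hDev : ∀ n ω s y, (D n).eval s y ω =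
      (g s y - (f n).eval s y (w n)) + -(g s y - (f n).eval s y ω) := by
    intro n ω s y
    have h2 : (((f n).map fun e => e.withWeight (-e.X (w n))).map
        fun e => e.eval s y ω).sum = -(f n).eval s y (w n) := by
      rw [List.map_map, SimpleProcess.eval, ← Fin.sum_univ_fun_getElem,
        ← Fin.sum_univ_fun_getElem, ← Finset.sum_neg_distrib]
      refine Finset.sum_congr rfl fun m _ => ?_
      simp [ElementaryProcess.eval, ElementaryProcess.withWeight]
    have h3 : (D n).eval s y ω = (f n).eval s y ω + -(f n).eval s y (w n) := by
      rw [SimpleProcess.eval, List.map_append, List.sum_append, h2]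
      rfl
    rw [h3]
    ring
  have hDle : ∀ n, ∫⁻ ω, rieszEnergy β (Set.Ioc 0 t) (fun s y => (D n).eval s y ω) ∂P ≤
      3 * (L n + ((n : ℝ≥0∞) + 1)⁻¹ + L n) := by
    intro n
    calc
      _ ≤ ∫⁻ ω, 3 * ((L n + ((n : ℝ≥0∞) + 1)⁻¹) +
            rieszEnergy β (Set.Ioc 0 t) (fun s y => g s y - (f n).eval s y ω)) ∂P := by
          refine lintegral_mono fun ω => ?_
          simp only [hDev]
          have m1 : Measurable (Function.uncurry fun s y => g s y - (f n).eval s y (w n)) :=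
            hg.sub ((f n).measurable_eval (w n))
          have m2 : Measurable (Function.uncurry fun s y => -(g s y - (f n).eval s y ω)) :=
            (hg.sub ((f n).measurable_eval ω)).neg
          refine (rieszEnergy_add_le hk hβ0 m1 m2).trans ?_
          rw [rieszEnergy_neg]
          gcongr
          exact hw n
      _ = _ := by
          rw [lintegral_const_mul' _ _ (by norm_num), lintegral_add_left measurable_const]
          simp [hL]
  have hlim : Tendsto (fun n => eLpNorm (fun ω => (D n).integral (M i) t ω) 2 P) atTop (𝓝 0) := by
    have t1 : Tendsto (fun n : ℕ => ((n : ℝ≥0∞) + 1)⁻¹) atTop (𝓝 0) := by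
      have := (tendsto_add_atTop_iff_nat 1).2 ENNReal.tendsto_inv_nat_nhds_zero
      simpa using this
    have t2 : Tendsto (fun n => 3 * (L n + ((n : ℝ≥0∞) + 1)⁻¹ + L n)) atTop (𝓝 0) := by
      have := ENNReal.Tendsto.const_mul (a := 3) ((hf.add t1).add hf) (Or.inr (by norm_num))
      simpa using this
    have t3 : Tendsto (fun n => (3 * (L n + ((n : ℝ≥0∞) + 1)⁻¹ + L n)) ^ (1 / 2 : ℝ)) atTop
        (𝓝 0) := by
      have := (ENNReal.continuous_rpow_const (y := 1 / 2)).tendsto 0 |>.comp t2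
      simpa [Function.comp_def] using this
    refine tendsto_of_tendsto_of_tendsto_of_le_of_le tendsto_const_nhds t3 (fun _ => zero_le)
      fun n => ?_
    exact ((D n).eLpNorm_integral_le hβ0 hβk hF hM i ht).trans (by gcongr; exact hDle n)
  have hZ : ∀ n, HasGaussianLaw (Z n) P := fun n =>
    hasGaussianLaw_frozen_integral hF hM (f n) i ht fun m => ((f n).get m).X (w n)
  refine hasGaussianLaw_of_tendsto_eLpNorm hZ hY2.1 ?_
  have hsum := hlim.add hfY
  rw [add_zero] at hsum
  refine tendsto_of_tendsto_of_tendsto_of_le_of_le tendsto_const_nhds hsum (fun _ => zero_le)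
    fun n => ?_
  have e : (fun ω => Z n ω - Y ω) = (fun ω => -(D n).integral (M i) t ω) +
      fun ω => (f n).integral (M i) t ω - Y ω := by
    ext ω
    simp only [Pi.add_apply, hDint]
    ring
  have hD2 := (D n).memLp_integral hF hM i ht
  simp only [e]
  refine (eLpNorm_add_le hD2.1.neg (((f n).memLp_integral hF hM i ht).1.sub hY2.1)
    (by norm_num)).trans ?_
  exact add_le_add (le_of_eq (eLpNorm_neg _ _ _)) le_rfl

/-- Duality between a Walsh integral of a deterministic function and the increments of `M`. -/
theorem IsWalshIntegral.integral_mul_increment [IsProbabilityMeasure P] (hβ0 : 0 < β) (hβk : β < k)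
    (hF : IsRieszNoise P β F) (hM : IsMartingaleMeasureOf P β F M) {i : Fin d} {t : ℝ} (ht : 0 ≤ t)
    {g : ℝ → Eucl k → ℝ} (hg : Measurable (Function.uncurry g)) {Y : Ω → ℝ}
    (hY : IsWalshIntegral P β (naturalFiltration P M) (M i) t (fun s y _ => g s y) Y) (j : Fin d)
    {a b : ℝ} (ha : 0 ≤ a) (hab : a < b) {B : Set (Eucl k)} (hB : MeasurableSet B)
    (hbB : Bornology.IsBounded B) :
    ∫ ω, Y ω * (M j b B ω - M j a B ω) ∂P =
      (if i = j then 1 else 0) * rieszForm β (Set.Ioc 0 t) g (box (Set.Ioc a b) B) ∧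
    Integrable (rieszIntegrand β g (box (Set.Ioc a b) B)) (rieszMeasure k (Set.Ioc 0 t)) := by
  have hk : 0 < k := by
    have : (0 : ℝ) < k := hβ0.trans hβk
    exact_mod_cast this
  obtain ⟨hY2, f, hf, hfY⟩ := hY
  set h : ℝ → Eucl k → ℝ := box (Set.Ioc a b) B with hh
  have mh : Measurable (Function.uncurry h) := measurable_box measurableSet_Ioc hB
  have eh : rieszEnergy β (Set.Ioc 0 t) h < ∞ := rieszEnergy_box_lt_top hβ0 hβk measurableSet_Ioc
    ((measure_mono Set.inter_subset_left).trans_lt measure_Ioc_lt_top) hbB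
  -- One simple process at finite distance from `g`, at one sample point, already forces finite
  -- energy.
  have eg : rieszEnergy β (Set.Ioc 0 t) g < ∞ := by
    obtain ⟨n, hn⟩ := (hf.eventually_lt_const (u := 1) (by simp)).exists
    obtain ⟨ω, hω⟩ := exists_le_lintegral_add (P := P)
      (fun ω => rieszEnergy β (Set.Ioc 0 t) fun s y => g s y - (f n).eval s y ω) one_ne_zero
    exact rieszEnergy_lt_top_of_sub hk hβ0 hg ((f n).measurable_eval ω)
      ((f n).rieszEnergy_eval_lt_top hβ0 hβk ω)
      (hω.trans_lt (ENNReal.add_lt_top.2 ⟨hn.trans (by simp), by simp⟩))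
  have ig : Integrable (rieszIntegrand β g h) (rieszMeasure k (Set.Ioc 0 t)) :=
    integrable_rieszIntegrand hg mh (rieszMutual_lt_top hk hβ0 hg mh eg eh)
  refine ⟨?_, ig⟩
  have hG2 : MemLp (fun ω => M j b B ω - M j a B ω) 2 P :=
    (memLp_cellValue hF hM j (ha.trans hab.le) hB hbB).sub (memLp_cellValue hF hM j ha hB hbB)
  have l1 := tendsto_integral_mul_of_tendsto_eLpNorm
    (fun n => (f n).memLp_integral hF hM i ht) (fun _ => hG2) hY2 hG2 hfY (by simp)
  simp only [fun n => (f n).integral_mul_increment hβ0 hβk hF hM i j ht ha hab hB hbB] at l1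
  refine tendsto_nhds_unique l1 (Tendsto.const_mul _ ?_)
  let D : ℕ → Ω → ℝ := fun n ω => rieszForm β (Set.Ioc 0 t) g h -
    rieszForm β (Set.Ioc 0 t) (fun s y => (f n).eval s y ω) h
  have hDi : ∀ n, Integrable
      (fun ω => rieszForm β (Set.Ioc 0 t) (fun s y => (f n).eval s y ω) h) P := by
    intro n
    simp only [fun ω => (f n).rieszForm_eval_left (I := Set.Ioc 0 t) hβ0 hβk ω mh eh]
    exact integrable_finsetSum _ fun m _ => (((f n).get m).integrable_X hM).mul_const _
  -- The bound is quadratic because convergence is given for the expected energy; passing from `L¹`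
  -- to `L²` then bounds the mean of `D n`.
  have hDb : ∀ n ω, ‖D n ω‖ₑ ^ 2 ≤ rieszEnergy β (Set.Ioc 0 t)
      (fun s y => g s y - (f n).eval s y ω) * rieszEnergy β (Set.Ioc 0 t) h := by
    intro n ω
    have m1 : Measurable (Function.uncurry fun s y => g s y - (f n).eval s y ω) :=
      hg.sub ((f n).measurable_eval ω)
    have e : D n ω = rieszForm β (Set.Ioc 0 t) (fun s y => g s y - (f n).eval s y ω) h :=
      (rieszForm_sub_left ig ((f n).integrable_rieszIntegrand_eval hβ0 hβk ω mh eh)).symm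
    rw [e]
    calc
      _ ≤ (rieszEnergy β (Set.Ioc 0 t) (fun s y => g s y - (f n).eval s y ω) ^ (1 / 2 : ℝ) *
            rieszEnergy β (Set.Ioc 0 t) h ^ (1 / 2 : ℝ)) ^ 2 := by
          gcongr
          exact (enorm_rieszForm_le m1 mh).trans (rieszMutual_le hk hβ0 m1 mh)
      _ = _ := by
          rw [← ENNReal.mul_rpow_of_nonneg _ _ (by norm_num), ← ENNReal.rpow_natCast,
            ← ENNReal.rpow_mul]
          norm_num
  have hDm : ∀ n, AEStronglyMeasurable (D n) P := fun n =>
    aestronglyMeasurable_const.sub (hDi n).1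
  have hD0 : Tendsto (fun n => ∫ ω, D n ω ∂P) atTop (𝓝 0) := by
    rw [tendsto_zero_iff_enorm_tendsto_zero]
    have t1 : Tendsto (fun n => ((∫⁻ ω, rieszEnergy β (Set.Ioc 0 t)
        (fun s y => g s y - (f n).eval s y ω) ∂P) * rieszEnergy β (Set.Ioc 0 t) h) ^ (1 / 2 : ℝ))
        atTop (𝓝 0) := by
      have t2 := ENNReal.Tendsto.mul_const (b := rieszEnergy β (Set.Ioc 0 t) h) hf
        (Or.inr eh.ne)
      have := (ENNReal.continuous_rpow_const (y := 1 / 2)).tendsto _ |>.comp t2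
      simpa [Function.comp_def] using this
    refine tendsto_of_tendsto_of_tendsto_of_le_of_le tendsto_const_nhds t1 (fun _ => zero_le)
      fun n => ?_
    calc
      ‖∫ ω, D n ω ∂P‖ₑ ≤ ∫⁻ ω, ‖D n ω‖ₑ ∂P := enorm_integral_le_lintegral_enorm _
      _ = eLpNorm (D n) 1 P := eLpNorm_one_eq_lintegral_enorm.symm
      _ ≤ eLpNorm (D n) 2 P := eLpNorm_le_eLpNorm_of_exponent_le (by norm_num) (hDm n)
      _ = (∫⁻ ω, ‖D n ω‖ₑ ^ 2 ∂P) ^ (1 / 2 : ℝ) := by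
          rw [eLpNorm_eq_lintegral_rpow_enorm_toReal (by norm_num) (by norm_num)]
          simp
      _ ≤ _ := by
          gcongr
          rw [← lintegral_mul_const' _ _ eh.ne]
          exact lintegral_mono (hDb n)
  have e : ∀ n, ∫ ω, rieszForm β (Set.Ioc 0 t) (fun s y => (f n).eval s y ω) h ∂P =
      rieszForm β (Set.Ioc 0 t) g h - ∫ ω, D n ω ∂P := by
    intro n
    rw [integral_sub (integrable_const _) (hDi n)]
    simp
  have hlim := hD0.const_sub (rieszForm β (Set.Ioc 0 t) g h)
  rw [sub_zero] at hlim
  exact hlim.congr fun n => (e n).symm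

end Walsh

/-! ### Heat averages of the Riesz potential of a ball, near and far. -/

section HeatEstimates

variable {k : ℕ} {β : ℝ}

/-- The integrand `(r, y) ↦ S(t - r, x - y)`. -/
def heatShift (t : ℝ) (x : Eucl k) (r : ℝ) (y : Eucl k) : ℝ := heatKernel (t - r) (x - y)

theorem measurable_heatShift (t : ℝ) (x : Eucl k) :
    Measurable (Function.uncurry (heatShift t x)) := by
  unfold heatShift heatKernel Function.uncurry
  fun_prop

theorem heatKernel_nonneg {τ : ℝ} (hτ : 0 ≤ τ) (w : Eucl k) : 0 ≤ heatKernel τ w := by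
  unfold heatKernel
  positivity

/-- The case `b = 2` is the unit mass of the heat kernel; `b = 4` is what remains after spending
half of the exponent on decay. -/
theorem lintegral_gaussian {τ b : ℝ} (hτ : 0 < τ) (hb : 0 < b) (x : Eucl k) :
    ∫⁻ y, ENNReal.ofReal ((2 * Real.pi * τ) ^ (-(k : ℝ) / 2) *
      Real.exp (-(‖x - y‖ ^ 2 / (b * τ)))) = ENNReal.ofReal ((b / 2) ^ ((k : ℝ) / 2)) := by
  have e : ∀ y : Eucl k, ENNReal.ofReal ((2 * Real.pi * τ) ^ (-(k : ℝ) / 2) *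
      Real.exp (-(‖x - y‖ ^ 2 / (b * τ)))) = ENNReal.ofReal ((2 * Real.pi * τ) ^ (-(k : ℝ) / 2)) *
        ENNReal.ofReal (Real.exp (-(1 / (b * τ)) * ‖y - x‖ ^ 2)) := by
    intro y
    rw [← ENNReal.ofReal_mul (by positivity), norm_sub_rev]
    congr 3
    ring
  simp_rw [e]
  rw [lintegral_const_mul' _ _ ENNReal.ofReal_ne_top,
    lintegral_sub_right_eq_self
      (fun w : Eucl k => ENNReal.ofReal (Real.exp (-(1 / (b * τ)) * ‖w‖ ^ 2))),
    lintegral_exp_neg_mul_sq_norm (by positivity), ← ENNReal.ofReal_mul (by positivity)]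
  congr 1
  rw [neg_div, Real.rpow_neg (by positivity), ← Real.inv_rpow (by positivity),
    ← Real.mul_rpow (by positivity) (by positivity)]
  congr 1
  field_simp

/-- For nonnegative functions the form is the mutual energy. -/
theorem ofReal_rieszForm {I : Set ℝ} (hI : MeasurableSet I) {u v : ℝ → Eucl k → ℝ}
    (hu : Measurable (Function.uncurry u)) (hv : Measurable (Function.uncurry v))
    (hu0 : ∀ r ∈ I, ∀ y, 0 ≤ u r y) (hv0 : ∀ r y, 0 ≤ v r y)
    (hi : Integrable (rieszIntegrand β u v) (rieszMeasure k I)) :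
    ENNReal.ofReal (rieszForm β I u v) = rieszMutual β I u v := by
  have h0 : ∀ᵐ p ∂(rieszMeasure k I), 0 ≤ rieszIntegrand β u v p := by
    have : ∀ᵐ p ∂(rieszMeasure k I), p.1 ∈ I :=
      Measure.quasiMeasurePreserving_fst.ae (ae_restrict_mem hI)
    filter_upwards [this] with p hp
    have h1 := hu0 p.1 hp p.2.1
    have h2 := hv0 p.1 p.2.2
    unfold rieszIntegrand
    positivity
  rw [rieszForm, ofReal_integral_eq_lintegral_ofReal hi h0, rieszMutual_eq_lintegral hu hv]
  refine lintegral_congr_ae ?_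
  filter_upwards [h0] with p hp
  rw [← ofReal_norm, Real.norm_of_nonneg hp]

theorem box_nonneg (S : Set ℝ) (A : Set (Eucl k)) (r : ℝ) (y : Eucl k) : 0 ≤ box S A r y :=
  Set.indicator_nonneg (fun _ _ => zero_le_one) _

theorem rieszMutual_box_right {I : Set ℝ} {u : ℝ → Eucl k → ℝ} {S : Set ℝ}
    {B : Set (Eucl k)} (hB : MeasurableSet B) :
    rieszMutual β I u (box S B) = ∫⁻ r in I, S.indicator (fun r =>
      ∫⁻ y, ENNReal.ofReal |u r y| * ∫⁻ z in B, ENNReal.ofReal (‖y - z‖ ^ (-β))) r := by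
  refine lintegral_congr fun r => ?_
  by_cases hr : r ∈ S
  · rw [Set.indicator_of_mem hr]
    refine lintegral_congr fun y => ?_
    rw [← lintegral_const_mul' _ _ ENNReal.ofReal_ne_top, ← lintegral_indicator hB]
    refine lintegral_congr fun z => ?_
    by_cases hz : z ∈ B
    · simp [box, hr, hz, ENNReal.ofReal_mul]
    · simp [box, hz]
  · rw [Set.indicator_of_notMem hr]
    simp [box, hr]

/-- The constant in the lower bound for the potential of the heat kernel on its own scale. -/
def heatConst (k : ℕ) (β : ℝ) : ℝ :=
  volume.real (Metric.ball (0 : Eucl k) 1) ^ 2 * (4 * Real.pi) ^ (-(k : ℝ) / 2) *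
    Real.exp (-(1 / 4)) * 2 ^ (-β)

theorem heatConst_pos (k : ℕ) (β : ℝ) : 0 < heatConst k β := by
  have : 0 < volume.real (Metric.ball (0 : Eucl k) 1) :=
    ENNReal.toReal_pos (Metric.measure_ball_pos _ _ one_pos).ne' measure_ball_lt_top.ne
  unfold heatConst
  positivity

/-- On the ball of radius `σ = √(τ/2) ≤ ρ` the heat kernel is at least `(2πτ)^{-k/2} e^{-1/4}`, and
there the potential is at least `(2ρ)^{-β}` times the volume of the `ρ`-ball. The factor `σ^k`
cancels `τ^{-k/2}`, so the bound is uniform in `τ`. -/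
theorem le_lintegral_heat_potential (hk : 0 < k) (hβ0 : 0 < β) {τ ρ : ℝ} (hτ : 0 < τ) (hρ : 0 < ρ)
    (hτρ : τ ≤ 2 * ρ ^ 2) (x : Eucl k) :
    ENNReal.ofReal (heatConst k β * ρ ^ ((k : ℝ) - β)) ≤
      ∫⁻ y, ENNReal.ofReal |heatKernel τ (x - y)| *
        ∫⁻ z in Metric.ball x ρ, ENNReal.ofReal (‖y - z‖ ^ (-β)) := by
  have : Nonempty (Fin k) := ⟨⟨0, hk⟩⟩
  set σ := √(τ / 2) with hσ
  have hσ0 : 0 < σ := by positivity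
  have hσ2 : σ ^ 2 = τ / 2 := Real.sq_sqrt (by positivity)
  have hσρ : σ ≤ ρ := by
    rw [hσ]
    exact Real.sqrt_le_iff.2 ⟨hρ.le, by linarith⟩
  set V := volume.real (Metric.ball (0 : Eucl k) 1) with hV
  have hVe : volume (Metric.ball (0 : Eucl k) 1) = ENNReal.ofReal V :=
    (ENNReal.ofReal_toReal measure_ball_lt_top.ne).symm
  have hV0 : 0 ≤ V := measureReal_nonneg
  calc
    ENNReal.ofReal (heatConst k β * ρ ^ ((k : ℝ) - β))
      = ENNReal.ofReal ((2 * Real.pi * τ) ^ (-(k : ℝ) / 2) * Real.exp (-(1 / 4))) *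
          (ENNReal.ofReal ((2 * ρ) ^ (-β)) * volume (Metric.ball x ρ)) *
          volume (Metric.ball x σ) := by
        rw [volume_ball_eucl x hρ, volume_ball_eucl x hσ0, hVe]
        simp only [← ENNReal.ofReal_mul (show 0 ≤ ρ ^ (k : ℝ) by positivity),
          ← ENNReal.ofReal_mul (show 0 ≤ σ ^ (k : ℝ) by positivity),
          ← ENNReal.ofReal_mul (show 0 ≤ (2 * ρ) ^ (-β) by positivity)]
        rw [← ENNReal.ofReal_mul (by positivity), ← ENNReal.ofReal_mul (by positivity)]
        congr 1
        have e1 : σ ^ (k : ℝ) = (τ / 2) ^ ((k : ℝ) / 2) := by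
          rw [← hσ2, ← Real.rpow_natCast σ 2, ← Real.rpow_mul hσ0.le]
          congr 1
          push_cast
          ring
        have e2 : (2 * Real.pi * τ) ^ (-(k : ℝ) / 2) * (τ / 2) ^ ((k : ℝ) / 2) =
            (4 * Real.pi) ^ (-(k : ℝ) / 2) := by
          rw [neg_div, Real.rpow_neg (by positivity), Real.rpow_neg (by positivity),
            ← Real.inv_rpow (by positivity), ← Real.inv_rpow (by positivity),
            ← Real.mul_rpow (by positivity) (by positivity)]
          congr 1
          field_simp
          norm_num
        have e3 : (2 * ρ) ^ (-β) * ρ ^ (k : ℝ) = 2 ^ (-β) * ρ ^ ((k : ℝ) - β) := by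
          rw [Real.mul_rpow (by norm_num) hρ.le, mul_assoc, ← Real.rpow_add hρ]
          ring_nf
        rw [heatConst, ← hV, e1, ← e2]
        linear_combination (-(V ^ 2 * (2 * Real.pi * τ) ^ (-(k : ℝ) / 2) *
          (τ / 2) ^ ((k : ℝ) / 2) * Real.exp (-(1 / 4)))) * e3
    _ = ∫⁻ y in Metric.ball x σ,
          ENNReal.ofReal ((2 * Real.pi * τ) ^ (-(k : ℝ) / 2) * Real.exp (-(1 / 4))) *
          ∫⁻ z in Metric.ball x ρ, ENNReal.ofReal ((2 * ρ) ^ (-β)) := by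
        rw [setLIntegral_const, setLIntegral_const]
    _ ≤ ∫⁻ y in Metric.ball x σ, ENNReal.ofReal |heatKernel τ (x - y)| *
          ∫⁻ z in Metric.ball x ρ, ENNReal.ofReal (‖y - z‖ ^ (-β)) := by
        refine setLIntegral_mono' measurableSet_ball fun y hy => ?_
        rw [Metric.mem_ball, dist_eq_norm] at hy
        refine mul_le_mul' (ENNReal.ofReal_le_ofReal ?_) ?_
        · rw [abs_of_nonneg (heatKernel_nonneg hτ.le _), heatKernel]
          gcongr
          rw [neg_div, neg_le_neg_iff, div_le_iff₀ (by positivity), norm_sub_rev]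
          have : ‖y - x‖ ^ 2 ≤ σ ^ 2 := by gcongr
          linarith
        · have hne : ∀ᵐ z : Eucl k, z ≠ y := by simp [ae_iff]
          refine lintegral_mono_ae ?_
          filter_upwards [ae_restrict_of_ae hne, ae_restrict_mem measurableSet_ball] with z hz hzb
          refine ENNReal.ofReal_le_ofReal ?_
          have hpos : 0 < ‖y - z‖ := norm_pos_iff.2 (sub_ne_zero.2 hz.symm)
          refine Real.rpow_le_rpow_of_nonpos hpos ?_ (by linarith)
          rw [Metric.mem_ball, dist_eq_norm, norm_sub_rev] at hzb
          calc
            ‖y - z‖ = ‖(y - x) + (x - z)‖ := by congr 1; abel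
            _ ≤ ‖y - x‖ + ‖x - z‖ := norm_add_le _ _
            _ ≤ 2 * ρ := by linarith
    _ ≤ _ := lintegral_mono' Measure.restrict_le_self le_rfl

/-- Split according to the distance from `w` to `y`. Within `‖x-y‖/2`, the ball is far from `w` and
its potential carries a factor `η^β`. Beyond, the potential is only `O(ρ^{k-β})`, but half of the
Gaussian exponent yields `16 η²`. Both factors vanish with `η`, so the contribution of `y` can be
made negligible against that of `x`. -/
theorem lintegral_heat_potential_le {C : ℝ} (hC0 : 0 < C)
    (hC : ∀ ρ : ℝ, 0 < ρ → ∀ x y : Eucl k,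
      ∫⁻ z in Metric.ball x ρ, ENNReal.ofReal (‖y - z‖ ^ (-β)) ≤
        ENNReal.ofReal (C * ρ ^ ((k : ℝ) - β))) (hβ0 : 0 < β)
    {τ ρ η : ℝ} (hτ : 0 < τ) (hη : 0 < η) (hη4 : η ≤ 1 / 4) {x y : Eucl k} (hxy : x ≠ y)
    (hρ : ρ = η * ‖x - y‖) (hτρ : τ ≤ ρ ^ 2) :
    ∫⁻ w, ENNReal.ofReal |heatKernel τ (y - w)| *
        ∫⁻ z in Metric.ball x ρ, ENNReal.ofReal (‖w - z‖ ^ (-β)) ≤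
      ENNReal.ofReal ((volume.real (Metric.ball (0 : Eucl k) 1) * 4 ^ β * η ^ β +
        C * 2 ^ ((k : ℝ) / 2) * (16 * η ^ 2)) * ρ ^ ((k : ℝ) - β)) := by
  set δ := ‖x - y‖ with hδ
  have hδ0 : 0 < δ := norm_pos_iff.2 (sub_ne_zero.2 hxy)
  have hρ0 : 0 < ρ := by rw [hρ]; positivity
  set V := volume.real (Metric.ball (0 : Eucl k) 1) with hV
  have hVe : volume (Metric.ball (0 : Eucl k) 1) = ENNReal.ofReal V :=
    (ENNReal.ofReal_toReal measure_ball_lt_top.ne).symm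
  have hV0 : 0 ≤ V := measureReal_nonneg
  have hexp : ∀ u : ℝ, 0 < u → Real.exp (-u) ≤ 1 / u := by
    intro u hu
    rw [Real.exp_neg, ← one_div]
    exact one_div_le_one_div_of_le hu (by linarith [Real.add_one_le_exp u])
  have hpt : ∀ w : Eucl k, ENNReal.ofReal |heatKernel τ (y - w)| *
        ∫⁻ z in Metric.ball x ρ, ENNReal.ofReal (‖w - z‖ ^ (-β)) ≤
      ENNReal.ofReal ((2 * Real.pi * τ) ^ (-(k : ℝ) / 2) * Real.exp (-(‖y - w‖ ^ 2 / (2 * τ)))) *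
        ENNReal.ofReal (V * 4 ^ β * η ^ β * ρ ^ ((k : ℝ) - β)) +
      ENNReal.ofReal ((2 * Real.pi * τ) ^ (-(k : ℝ) / 2) * Real.exp (-(‖y - w‖ ^ 2 / (4 * τ)))) *
        ENNReal.ofReal (16 * η ^ 2 * (C * ρ ^ ((k : ℝ) - β))) := by
    intro w
    rw [abs_of_nonneg (heatKernel_nonneg hτ.le _)]
    by_cases hw : ‖y - w‖ < δ / 2
    · refine le_add_right (mul_le_mul' (le_of_eq ?_) ?_)
      · rw [heatKernel, neg_div (2 * τ)]
      · calc
          _ ≤ ∫⁻ z in Metric.ball x ρ, ENNReal.ofReal ((δ / 4) ^ (-β)) := by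
              refine setLIntegral_mono' measurableSet_ball fun z hz => ?_
              refine ENNReal.ofReal_le_ofReal
                (Real.rpow_le_rpow_of_nonpos (by positivity) ?_ (by linarith))
              rw [Metric.mem_ball, dist_eq_norm] at hz
              have h1 : δ ≤ ‖z - x‖ + ‖w - z‖ + ‖y - w‖ := by
                rw [hδ, norm_sub_rev z x, norm_sub_rev w z, norm_sub_rev y w]
                calc
                  ‖x - y‖ = ‖(x - z) + (z - w) + (w - y)‖ := by congr 1; abel
                  _ ≤ _ := norm_add₃_le
              -- This uses `η ≤ 1/4`: of the distance `δ`, at most `δ/4` is spent in the ball and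
              -- `δ/2` near `y`, leaving `δ/4` between `w` and `z`.
              have h2 : ρ ≤ δ / 4 := by rw [hρ]; nlinarith
              linarith
          _ = _ := by
              rw [setLIntegral_const, volume_ball_eucl x hρ0, hVe,
                ← ENNReal.ofReal_mul (by positivity), ← ENNReal.ofReal_mul (by positivity)]
              congr 1
              have hδρ : δ / 4 = ρ * (4 * η)⁻¹ := by rw [hρ]; field_simp
              rw [hδρ, Real.mul_rpow hρ0.le (by positivity), Real.inv_rpow (by positivity),
                Real.rpow_neg (by positivity : (0 : ℝ) ≤ 4 * η), inv_inv,
                Real.mul_rpow (by norm_num) hη.le]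
              have : ρ ^ ((k : ℝ) - β) = ρ ^ (-β) * ρ ^ (k : ℝ) := by
                rw [← Real.rpow_add hρ0]; ring_nf
              rw [this]
              ring
    · refine le_add_left ?_
      rw [not_lt] at hw
      refine (mul_le_mul' le_rfl (hC ρ hρ0 x w)).trans ?_
      rw [← ENNReal.ofReal_mul (heatKernel_nonneg hτ.le _), ← ENNReal.ofReal_mul (by positivity)]
      refine ENNReal.ofReal_le_ofReal ?_
      have h1 : Real.exp (-(‖y - w‖ ^ 2 / (2 * τ))) ≤
          Real.exp (-(‖y - w‖ ^ 2 / (4 * τ))) * (16 * η ^ 2) := by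
        have h2 : -(‖y - w‖ ^ 2 / (2 * τ)) =
            -(‖y - w‖ ^ 2 / (4 * τ)) + -(‖y - w‖ ^ 2 / (4 * τ)) := by field_simp; ring
        have hyw : 0 < ‖y - w‖ := lt_of_lt_of_le (by positivity) hw
        have h3 : Real.exp (-(‖y - w‖ ^ 2 / (4 * τ))) ≤ 16 * η ^ 2 := by
          refine (hexp _ (by positivity)).trans ?_
          rw [one_div_div, div_le_iff₀ (by positivity)]
          have h4 : (δ / 2) ^ 2 ≤ ‖y - w‖ ^ 2 := by gcongr
          have h5 : τ ≤ η ^ 2 * δ ^ 2 := by rw [hρ, mul_pow] at hτρ; exact hτρ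
          have h6 : 16 * η ^ 2 * (δ / 2) ^ 2 ≤ 16 * η ^ 2 * ‖y - w‖ ^ 2 := by gcongr
          nlinarith
        rw [h2, Real.exp_add]
        exact mul_le_mul_of_nonneg_left h3 (Real.exp_pos _).le
      rw [heatKernel, neg_div (2 * τ)]
      calc
        _ ≤ (2 * Real.pi * τ) ^ (-(k : ℝ) / 2) *
            (Real.exp (-(‖y - w‖ ^ 2 / (4 * τ))) * (16 * η ^ 2)) * (C * ρ ^ ((k : ℝ) - β)) := by
              gcongr
        _ = _ := by ring
  refine (lintegral_mono hpt).trans (le_of_eq ?_)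
  rw [lintegral_add_left (by fun_prop), lintegral_mul_const' _ _ ENNReal.ofReal_ne_top,
    lintegral_mul_const' _ _ ENNReal.ofReal_ne_top, lintegral_gaussian hτ (by norm_num),
    lintegral_gaussian hτ (by norm_num), ← ENNReal.ofReal_mul (by positivity),
    ← ENNReal.ofReal_mul (by positivity), ← ENNReal.ofReal_add (by positivity) (by positivity)]
  congr 1
  norm_num
  ring

end HeatEstimates

/-! ### The Riesz form of the heat kernel with a parabolic box. -/

section Pairing

variable {k : ℕ} {β : ℝ}

theorem le_rieszForm_heatShift (hk : 0 < k) (hβ0 : 0 < β) {a b t ρ : ℝ} (ha : 0 ≤ a) (hab : a < b)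
    (hbt : b ≤ t) (hρ : 0 < ρ) (htρ : t - a ≤ 2 * ρ ^ 2) (x : Eucl k)
    (hi : Integrable (rieszIntegrand β (heatShift t x) (box (Set.Ioc a b) (Metric.ball x ρ)))
      (rieszMeasure k (Set.Ioc 0 t))) :
    heatConst k β * ρ ^ ((k : ℝ) - β) * (b - a) ≤
      rieszForm β (Set.Ioc 0 t) (heatShift t x) (box (Set.Ioc a b) (Metric.ball x ρ)) := by
  have hpos : 0 < heatConst k β * ρ ^ ((k : ℝ) - β) * (b - a) := by
    have := heatConst_pos k β
    have := sub_pos.2 hab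
    positivity
  have h : ENNReal.ofReal (heatConst k β * ρ ^ ((k : ℝ) - β) * (b - a)) ≤ ENNReal.ofReal
      (rieszForm β (Set.Ioc 0 t) (heatShift t x) (box (Set.Ioc a b) (Metric.ball x ρ))) := by
    rw [ofReal_rieszForm measurableSet_Ioc (measurable_heatShift t x)
      (measurable_box measurableSet_Ioc measurableSet_ball)
      (fun r hr y => heatKernel_nonneg (sub_nonneg.2 hr.2) _) (box_nonneg _ _) hi,
      rieszMutual_box_right measurableSet_ball]
    calc
      _ = ∫⁻ r in Set.Ioc 0 t, (Set.Ioo a b).indicator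
          -- The open interval loses no length and excludes `r = t`, where the time lag would be
          -- zero.
          (fun _ => ENNReal.ofReal (heatConst k β * ρ ^ ((k : ℝ) - β))) r := by
          have hsub : Set.Ioo a b ⊆ Set.Ioc 0 t := fun r hr =>
            ⟨ha.trans_lt hr.1, hr.2.le.trans hbt⟩
          rw [lintegral_indicator measurableSet_Ioo, setLIntegral_const,
            Measure.restrict_apply measurableSet_Ioo, Set.inter_eq_left.2 hsub,
            Real.volume_Ioo,
            ← ENNReal.ofReal_mul]
          have := heatConst_pos k β
          positivity
      _ ≤ _ := by
          refine lintegral_mono fun r => ?_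
          by_cases hr : r ∈ Set.Ioo a b
          · rw [Set.indicator_of_mem hr, Set.indicator_of_mem (Set.Ioo_subset_Ioc_self hr)]
            exact le_lintegral_heat_potential hk hβ0 (by linarith [hr.2]) hρ
              (by linarith [hr.1]) x
          · rw [Set.indicator_of_notMem hr]
            exact zero_le
  rcases ENNReal.ofReal_le_ofReal_iff'.1 h with h | h
  · exact h
  · exact absurd h (not_le.2 hpos)

theorem rieszForm_heatShift_le {C : ℝ} (hC0 : 0 < C)
    (hC : ∀ ρ : ℝ, 0 < ρ → ∀ x y : Eucl k,
      ∫⁻ z in Metric.ball x ρ, ENNReal.ofReal (‖y - z‖ ^ (-β)) ≤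
        ENNReal.ofReal (C * ρ ^ ((k : ℝ) - β))) (hβ0 : 0 < β)
    {a b s ρ η : ℝ} (hab : a < b) (hη : 0 < η) (hη4 : η ≤ 1 / 4) {x y : Eucl k} (hxy : x ≠ y)
    (hρ : ρ = η * ‖x - y‖) (hsρ : s - a ≤ ρ ^ 2)
    (hi : Integrable (rieszIntegrand β (heatShift s y) (box (Set.Ioc a b) (Metric.ball x ρ)))
      (rieszMeasure k (Set.Ioc 0 s))) :
    rieszForm β (Set.Ioc 0 s) (heatShift s y) (box (Set.Ioc a b) (Metric.ball x ρ)) ≤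
      (volume.real (Metric.ball (0 : Eucl k) 1) * 4 ^ β * η ^ β +
        C * 2 ^ ((k : ℝ) / 2) * (16 * η ^ 2)) * ρ ^ ((k : ℝ) - β) * (b - a) := by
  have hρ0 : 0 ≤ ρ := by rw [hρ]; positivity
  set E := (volume.real (Metric.ball (0 : Eucl k) 1) * 4 ^ β * η ^ β +
        C * 2 ^ ((k : ℝ) / 2) * (16 * η ^ 2)) * ρ ^ ((k : ℝ) - β) with hE
  have hE0 : 0 ≤ E := by
    have : 0 ≤ volume.real (Metric.ball (0 : Eucl k) 1) := measureReal_nonneg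
    positivity
  rw [← ENNReal.ofReal_le_ofReal_iff (mul_nonneg hE0 (sub_pos.2 hab).le),
    ofReal_rieszForm measurableSet_Ioc (measurable_heatShift s y)
      (measurable_box measurableSet_Ioc measurableSet_ball)
      (fun r hr y => heatKernel_nonneg (sub_nonneg.2 hr.2) _) (box_nonneg _ _) hi,
      rieszMutual_box_right measurableSet_ball]
  calc
    _ ≤ ∫⁻ r in Set.Ioc 0 s, (Set.Ioc a b).indicator (fun _ => ENNReal.ofReal E) r := by
        have hne : ∀ᵐ r : ℝ, r ≠ s := by simp [ae_iff]
        refine lintegral_mono_ae ?_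
        filter_upwards [ae_restrict_of_ae hne, ae_restrict_mem measurableSet_Ioc] with r hrs hr
        by_cases hrab : r ∈ Set.Ioc a b
        · rw [Set.indicator_of_mem hrab, Set.indicator_of_mem hrab]
          exact lintegral_heat_potential_le hC0 hC hβ0 (sub_pos.2 (lt_of_le_of_ne hr.2 hrs)) hη hη4
            hxy hρ (by linarith [hrab.1])
        · rw [Set.indicator_of_notMem hrab]
          exact zero_le
    _ ≤ ∫⁻ r, (Set.Ioc a b).indicator (fun _ => ENNReal.ofReal E) r :=
        lintegral_mono' Measure.restrict_le_self le_rfl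
    _ = _ := by
        rw [lintegral_indicator measurableSet_Ioc, setLIntegral_const, Real.volume_Ioc,
          ← ENNReal.ofReal_mul hE0]

/-- Causality: a solution at time `s` does not see noise after `s`. -/
theorem rieszForm_box_right_eq_zero {a b s : ℝ} (hsa : s ≤ a) (u : ℝ → Eucl k → ℝ)
    (B : Set (Eucl k)) : rieszForm β (Set.Ioc 0 s) u (box (Set.Ioc a b) B) = 0 := by
  refine integral_eq_zero_of_ae ?_
  have : ∀ᵐ p ∂(rieszMeasure k (Set.Ioc 0 s)), p.1 ∈ Set.Ioc 0 s :=
    Measure.quasiMeasurePreserving_fst.ae (ae_restrict_mem measurableSet_Ioc)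
  filter_upwards [this] with p hp
  have : p.1 ∉ Set.Ioc a b := fun h => absurd h.1 (not_lt.2 (hp.2.trans hsa))
  simp [rieszIntegrand, box, this]

/-- Up to a time factor `1`, this is the energy of the box over `(0, 1]`; it controls the variance
of the test variable. -/
theorem rieszPair_ball_le {C : ℝ} (hC0 : 0 < C)
    (hC : ∀ ρ : ℝ, 0 < ρ → ∀ x y : Eucl k,
      ∫⁻ z in Metric.ball x ρ, ENNReal.ofReal (‖y - z‖ ^ (-β)) ≤
        ENNReal.ofReal (C * ρ ^ ((k : ℝ) - β))) {ρ : ℝ} (hρ : 0 < ρ) (x : Eucl k) :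
    rieszPair β (Metric.ball x ρ) (Metric.ball x ρ) ≤
      C * volume.real (Metric.ball (0 : Eucl k) 1) * ρ ^ (2 * (k : ℝ) - β) := by
  have hV0 : 0 ≤ volume.real (Metric.ball (0 : Eucl k) 1) := measureReal_nonneg
  have hVe : volume (Metric.ball (0 : Eucl k) 1) =
      ENNReal.ofReal (volume.real (Metric.ball (0 : Eucl k) 1)) :=
    (ENNReal.ofReal_toReal measure_ball_lt_top.ne).symm
  have h1 := rieszForm_box (β := β) (I := Set.univ) (measurableSet_Ioc (a := (0 : ℝ)) (b := 1))
    (measurableSet_Ioc (a := (0 : ℝ)) (b := 1)) (Metric.ball x ρ) (Metric.ball x ρ)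
  rw [Set.inter_self, Set.inter_univ, Real.volume_real_Ioc_of_le zero_le_one, sub_zero,
    one_mul] at h1
  have m : Measurable (Function.uncurry (box (Set.Ioc (0 : ℝ) 1) (Metric.ball x ρ))) :=
    measurable_box measurableSet_Ioc measurableSet_ball
  have h2 := (enorm_rieszForm_le (β := β) (I := Set.univ) m m).trans
    (rieszEnergy_box_le hC measurableSet_Ioc hρ subset_rfl)
  rw [h1, Set.inter_univ, Real.volume_Ioc, sub_zero, ENNReal.ofReal_one, one_mul,
    volume_ball_eucl x hρ, hVe, ← ENNReal.ofReal_mul (by positivity),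
    ← ENNReal.ofReal_mul (by positivity), ← ofReal_norm,
    ENNReal.ofReal_le_ofReal_iff (by positivity)] at h2
  refine (le_abs_self _).trans (h2.trans (le_of_eq ?_))
  have : ρ ^ (2 * (k : ℝ) - β) = ρ ^ (k : ℝ) * ρ ^ ((k : ℝ) - β) := by
    rw [← Real.rpow_add hρ]
    ring_nf
  rw [this]
  ring

end Pairing

/-! ### Gaussian moments and lower bounds by duality. -/

section Moments

variable {Ω : Type*} [MeasurableSpace Ω] {P : Measure Ω}

/-- The absolute moment of order `q` of the standard normal law. -/
def gaussMoment (q : ℝ) : ℝ := ∫ x, |x| ^ q ∂(gaussianReal 0 1)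

theorem gaussMoment_nonneg (q : ℝ) : 0 ≤ gaussMoment q :=
  integral_nonneg fun _ => by positivity

theorem integral_abs_rpow_of_hasGaussianLaw {G : Ω → ℝ} (hG : HasGaussianLaw G P)
    (h0 : ∫ ω, G ω ∂P = 0) {q : ℝ} (hq : 0 < q) :
    ∫ ω, |G ω| ^ q ∂P = (∫ ω, G ω * G ω ∂P) ^ (q / 2) * gaussMoment q := by
  have := hG.isProbabilityMeasure
  have hvar : Var[G; P] = ∫ ω, G ω * G ω ∂P := by
    rw [variance_eq_sub hG.memLp_two, h0]
    simp [pow_two]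
  have hv0 : 0 ≤ Var[G; P] := variance_nonneg _ _
  have hmap := hG.map_eq_gaussianReal
  rw [h0] at hmap
  have hscale : gaussianReal 0 (Var[G; P]).toNNReal =
      (gaussianReal 0 1).map (√(Var[G; P]) * ·) := by
    rw [gaussianReal_map_const_mul, mul_zero]
    congr 1
    ext
    simp [Real.sq_sqrt hv0, hv0]
  have hcont : Continuous fun x : ℝ => |x| ^ q := by
    exact continuous_abs.rpow_const fun _ => Or.inr hq.le
  calc
    ∫ ω, |G ω| ^ q ∂P = ∫ x, |x| ^ q ∂(P.map G) := by
      rw [integral_map hG.aemeasurable hcont.aestronglyMeasurable]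
    _ = ∫ x, |√(Var[G; P]) * x| ^ q ∂(gaussianReal 0 1) := by
      rw [hmap, hscale, integral_map (by fun_prop) hcont.aestronglyMeasurable]
    _ = ∫ x, (Var[G; P]) ^ (q / 2) * |x| ^ q ∂(gaussianReal 0 1) := by
      refine integral_congr_ae (Eventually.of_forall fun x => ?_)
      simp only
      rw [abs_mul, abs_of_nonneg (Real.sqrt_nonneg _), Real.mul_rpow (Real.sqrt_nonneg _)
        (abs_nonneg _), Real.sqrt_eq_rpow, ← Real.rpow_mul hv0]
      ring_nf
    _ = _ := by rw [integral_const_mul, hvar, gaussMoment]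

/-- Lower bound for a moment by duality with a Gaussian variable. -/
theorem le_integral_rpow_of_pairing [IsProbabilityMeasure P] {V G : Ω → ℝ} {p q A B : ℝ}
    (hpq : p.HolderConjugate q) (hV : MemLp V (ENNReal.ofReal p) P) (hG : HasGaussianLaw G P)
    (h0 : ∫ ω, G ω ∂P = 0) (hA : 0 ≤ A) (hB : 0 < B) (hVG : A ≤ ∫ ω, V ω * G ω ∂P)
    (hGG : ∫ ω, G ω * G ω ∂P ≤ B) :
    (A / ((gaussMoment q ^ (1 / q) + 1) * √B)) ^ p ≤ ∫ ω, |V ω| ^ p ∂P := by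
  have hp0 := hpq.pos
  have hq0 := hpq.symm.pos
  set N := ∫ ω, |V ω| ^ p ∂P with hN
  have hN0 : 0 ≤ N := integral_nonneg fun _ => by positivity
  have hm := gaussMoment_nonneg q
  have hGG0 : 0 ≤ ∫ ω, G ω * G ω ∂P := integral_nonneg fun _ => mul_self_nonneg _
  have hH := integral_mul_norm_le_Lp_mul_Lq hpq hV (hG.memLp (p := ENNReal.ofReal q) (by simp))
  simp only [Real.norm_eq_abs] at hH
  rw [integral_abs_rpow_of_hasGaussianLaw hG h0 hq0, ← hN,
    Real.mul_rpow (by positivity) hm, ← Real.rpow_mul hGG0] at hH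
  have e1 : q / 2 * (1 / q) = 1 / 2 := by field_simp
  rw [e1, ← Real.sqrt_eq_rpow] at hH
  -- Adding `1` keeps the denominator positive without a proof that the Gaussian moment is nonzero.
  have h1 : A ≤ N ^ (1 / p) * ((gaussMoment q ^ (1 / q) + 1) * √B) := by
    calc
      A ≤ ∫ ω, |V ω| * |G ω| ∂P := by
        have := norm_integral_le_integral_norm (μ := P) fun ω => V ω * G ω
        simp only [norm_mul, Real.norm_eq_abs] at this
        exact hVG.trans ((le_abs_self _).trans this)
      _ ≤ N ^ (1 / p) * (√(∫ ω, G ω * G ω ∂P) * gaussMoment q ^ (1 / q)) := hH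
      _ ≤ N ^ (1 / p) * (√B * (gaussMoment q ^ (1 / q) + 1)) := by
        gcongr
        linarith
      _ = _ := by ring
  have h2 : A / ((gaussMoment q ^ (1 / q) + 1) * √B) ≤ N ^ (1 / p) := by
    rw [div_le_iff₀ (by positivity)]
    exact h1
  calc
    _ ≤ (N ^ (1 / p)) ^ p := Real.rpow_le_rpow (by positivity) h2 hp0.le
    _ = N := by
      rw [← Real.rpow_mul hN0, one_div, inv_mul_cancel₀ hp0.ne', Real.rpow_one]

end Moments

/-! ### Moments of the increments of the mild solution. -/

section Increments

variable {Ω : Type*} [MeasurableSpace Ω] {P : Measure Ω} {k d : ℕ} {β : ℝ}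
  {F : Fin d → SpaceTimeTest k → Ω → ℝ} {M : Fin d → ℝ → Set (Eucl k) → Ω → ℝ}
  {v : ℝ → Eucl k → Ω → Eucl d}

/-- The linear mild solution has moments of all orders. -/
theorem IsMildSolution.memLp [IsProbabilityMeasure P] (hβ0 : 0 < β) (hβk : β < k)
    (hF : IsRieszNoise P β F) (hM : IsMartingaleMeasureOf P β F M)
    (hv : IsMildSolution P β M (fun _ => 1) (fun _ => 0) v) {t : ℝ} (ht : 0 ≤ t) (x : Eucl k)
    (i : Fin d) {p : ℝ≥0∞} (hp : p ≠ ∞) : MemLp (fun ω => v t x ω i) p P := by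
  obtain ⟨Y, hY, -, hvY⟩ := hv.mild t x ht i
  have hYp : ∀ j, MemLp (Y j) p P := fun j => by
    have hg : Measurable (Function.uncurry fun s y =>
        heatKernel (t - s) (x - y) * (1 : Matrix (Fin d) (Fin d) ℝ) i j) :=
      (measurable_heatShift t x).mul_const _
    exact (IsWalshIntegral.hasGaussianLaw hβ0 hβk hF hM ht hg (hY j)).memLp hp
  have hsum : MemLp (fun ω => ∑ j, Y j ω) p P := memLp_finsetSum _ fun j _ => hYp j
  refine hsum.ae_eq ?_
  filter_upwards [hvY] with ω hω
  simpa using hω.symm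

/-- Pairing of the linear mild solution with an increment of the martingale measure. -/
theorem IsMildSolution.integral_mul_increment [IsProbabilityMeasure P] (hβ0 : 0 < β) (hβk : β < k)
    (hF : IsRieszNoise P β F) (hM : IsMartingaleMeasureOf P β F M)
    (hv : IsMildSolution P β M (fun _ => 1) (fun _ => 0) v) {t : ℝ} (ht : 0 ≤ t) (x : Eucl k)
    (i : Fin d) {a b : ℝ} (ha : 0 ≤ a) (hab : a < b) {B : Set (Eucl k)} (hB : MeasurableSet B)
    (hbB : Bornology.IsBounded B) :
    ∫ ω, v t x ω i * (M i b B ω - M i a B ω) ∂P =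
      rieszForm β (Set.Ioc 0 t) (heatShift t x) (box (Set.Ioc a b) B) ∧
    Integrable (rieszIntegrand β (heatShift t x) (box (Set.Ioc a b) B))
      (rieszMeasure k (Set.Ioc 0 t)) := by
  obtain ⟨Y, hY, -, hvY⟩ := hv.mild t x ht i
  have key : ∀ j, ∫ ω, Y j ω * (M i b B ω - M i a B ω) ∂P = (if j = i then 1 else 0) *
      rieszForm β (Set.Ioc 0 t) (fun s y => heatKernel (t - s) (x - y) *
        (1 : Matrix (Fin d) (Fin d) ℝ) i j) (box (Set.Ioc a b) B) ∧
      Integrable (rieszIntegrand β (fun s y => heatKernel (t - s) (x - y) *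
        (1 : Matrix (Fin d) (Fin d) ℝ) i j) (box (Set.Ioc a b) B))
        (rieszMeasure k (Set.Ioc 0 t)) := fun j => by
    have hg : Measurable (Function.uncurry fun s y =>
        heatKernel (t - s) (x - y) * (1 : Matrix (Fin d) (Fin d) ℝ) i j) :=
      (measurable_heatShift t x).mul_const _
    exact IsWalshIntegral.integral_mul_increment hβ0 hβk hF hM ht hg (hY j) i ha hab hB hbB
  have hii : (fun s y => heatKernel (t - s) (x - y) * (1 : Matrix (Fin d) (Fin d) ℝ) i i) =
      heatShift t x := by
    ext s y
    simp [heatShift]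
  refine ⟨?_, hii ▸ (key i).2⟩
  have hG2 : MemLp (fun ω => M i b B ω - M i a B ω) 2 P :=
    (memLp_cellValue hF hM i (ha.trans hab.le) hB hbB).sub (memLp_cellValue hF hM i ha hB hbB)
  have e : ∀ᵐ ω ∂P, v t x ω i * (M i b B ω - M i a B ω) =
      ∑ j, Y j ω * (M i b B ω - M i a B ω) := by
    filter_upwards [hvY] with ω hω
    rw [hω, ← Finset.sum_mul]
    simp
  rw [integral_congr_ae e, integral_finsetSum _ (by exact fun j _ => (hY j).1.integrable_mul hG2),
    Finset.sum_eq_single i]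
  · rw [(key i).1, hii, if_pos rfl, one_mul]
  · intro j _ hj
    rw [(key j).1, if_neg hj, zero_mul]
  · simp

/-- A lower bound for the moments of an increment of the linear mild solution, from a lower bound
for the pairing with the increment of `M` over a parabolic box of size `ρ`. -/
theorem IsMildSolution.le_moment_of_le_pairing [IsProbabilityMeasure P] (hβ0 : 0 < β) (hβk : β < k)
    {C : ℝ} (hC0 : 0 < C)
    (hC : ∀ ρ : ℝ, 0 < ρ → ∀ x y : Eucl k,
      ∫⁻ z in Metric.ball x ρ, ENNReal.ofReal (‖y - z‖ ^ (-β)) ≤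
        ENNReal.ofReal (C * ρ ^ ((k : ℝ) - β)))
    (hF : IsRieszNoise P β F) (hM : IsMartingaleMeasureOf P β F M)
    (hv : IsMildSolution P β M (fun _ => 1) (fun _ => 0) v) {p q : ℝ} (hpq : p.HolderConjugate q)
    {s t : ℝ} (hs : 0 ≤ s) (ht : 0 ≤ t) (x y : Eucl k) (i : Fin d) {a b ρ c : ℝ} (ha : 0 ≤ a)
    (hρ : 0 < ρ) (hab : b - a = ρ ^ 2) (hc : 0 < c)
    (hle : c * ρ ^ ((k : ℝ) - β) * (b - a) ≤
      rieszForm β (Set.Ioc 0 t) (heatShift t x) (box (Set.Ioc a b) (Metric.ball x ρ)) -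
        rieszForm β (Set.Ioc 0 s) (heatShift s y) (box (Set.Ioc a b) (Metric.ball x ρ))) :
    (c / ((gaussMoment q ^ (1 / q) + 1) *
      √(C * volume.real (Metric.ball (0 : Eucl k) 1))) * ρ ^ ((2 - β) / 2)) ^ p ≤
      ∫ ω, |v t x ω i - v s y ω i| ^ p ∂P := by
  have hlt : a < b := by
    have : 0 < ρ ^ 2 := by positivity
    linarith
  set B := Metric.ball x ρ with hB
  set V := volume.real (Metric.ball (0 : Eucl k) 1) with hV
  have hV0 : 0 < V :=
    ENNReal.toReal_pos (Metric.measure_ball_pos _ _ one_pos).ne' measure_ball_lt_top.ne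
  have hBm : MeasurableSet B := measurableSet_ball
  have hBb : Bornology.IsBounded B := Metric.isBounded_ball
  have hb : 0 ≤ b := ha.trans hlt.le
  let G : Ω → ℝ := fun ω => M i b B ω - M i a B ω
  have hGl : HasGaussianLaw G P :=
    (isGaussianProcess_cellValue hF hM).hasGaussianLaw_fun_sub
      (s := ⟨(i, b, B), hb, hBm, hBb⟩) (t := ⟨(i, a, B), ha, hBm, hBb⟩)
  have mb := memLp_cellValue hF hM i hb hBm hBb
  have ma := memLp_cellValue hF hM i ha hBm hBb
  have hG0 : ∫ ω, G ω ∂P = 0 := by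
    rw [integral_sub (mb.integrable (by norm_num)) (ma.integrable (by norm_num)),
      integral_cellValue hF hM i hb hBm hBb, integral_cellValue hF hM i ha hBm hBb, sub_zero]
  have hGG : ∫ ω, G ω * G ω ∂P ≤ ρ ^ 2 * (C * V * ρ ^ (2 * (k : ℝ) - β)) := by
    have h := integral_increment_mul_increment hβ0 hβk hF hM i i ha hlt.le hlt.le hBm hBb hBm hBb
    rw [if_pos rfl, one_mul, min_self, hab] at h
    change ∫ ω, (M i b B ω - M i a B ω) * (M i b B ω - M i a B ω) ∂P ≤ _
    rw [h]
    gcongr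
    exact rieszPair_ball_le hC0 hC hρ x
  have m1 := hv.memLp hβ0 hβk hF hM ht x i (p := 2) (by norm_num)
  have m2 := hv.memLp hβ0 hβk hF hM hs y i (p := 2) (by norm_num)
  have hVG : c * ρ ^ ((k : ℝ) - β) * (b - a) ≤ ∫ ω, (v t x ω i - v s y ω i) * G ω ∂P := by
    have e : ∀ ω, (v t x ω i - v s y ω i) * G ω = v t x ω i * G ω - v s y ω i * G ω :=
      fun ω => sub_mul _ _ _
    rw [integral_congr_ae (Eventually.of_forall e),
      integral_sub (by exact m1.integrable_mul hGl.memLp_two)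
        (by exact m2.integrable_mul hGl.memLp_two),
      (hv.integral_mul_increment hβ0 hβk hF hM ht x i ha hlt hBm hBb).1,
      (hv.integral_mul_increment hβ0 hβk hF hM hs y i ha hlt hBm hBb).1]
    exact hle
  have hmain := le_integral_rpow_of_pairing hpq
    ((hv.memLp hβ0 hβk hF hM ht x i ENNReal.ofReal_ne_top).sub
      (hv.memLp hβ0 hβk hF hM hs y i ENNReal.ofReal_ne_top)) hGl hG0
    (by rw [hab]; positivity) (by positivity) hVG hGG
  refine le_of_eq_of_le ?_ hmain
  congr 1
  -- Scaling: the pairing is of order `ρ^{k-β+2}` and the standard deviation bound of order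
  -- `ρ^{1+k-β/2}`; the quotient is `ρ^{(2-β)/2}`.
  have hsq : √(ρ ^ 2 * (C * V * ρ ^ (2 * (k : ℝ) - β))) =
      √(C * V) * (ρ * ρ ^ ((k : ℝ) - β / 2)) := by
    have e1 : ρ ^ 2 * (C * V * ρ ^ (2 * (k : ℝ) - β)) =
        (C * V) * (ρ * ρ ^ ((k : ℝ) - β / 2)) ^ 2 := by
      have : ρ ^ (2 * (k : ℝ) - β) = (ρ ^ ((k : ℝ) - β / 2)) ^ 2 := by
        rw [← Real.rpow_natCast, ← Real.rpow_mul hρ.le]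
        congr 1
        push_cast
        ring
      rw [this]
      ring
    rw [e1, Real.sqrt_mul (by positivity), Real.sqrt_sq (by positivity)]
  have hpow : ρ ^ ((2 - β) / 2) * (ρ * ρ ^ ((k : ℝ) - β / 2)) = ρ ^ ((k : ℝ) - β) * ρ ^ 2 := by
    have e1 : ρ * ρ ^ ((k : ℝ) - β / 2) = ρ ^ (1 + ((k : ℝ) - β / 2)) := by
      rw [Real.rpow_add hρ, Real.rpow_one]
    rw [e1, ← Real.rpow_add hρ, ← Real.rpow_natCast ρ 2, ← Real.rpow_add hρ]
    congr 1
    push_cast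
    ring
  rw [hsq, hab]
  have hm := gaussMoment_nonneg q
  have hm1 : 0 < gaussMoment q ^ (1 / q) + 1 := by positivity
  have hCV : 0 < √(C * V) := by positivity
  have hD : 0 < ρ * ρ ^ ((k : ℝ) - β / 2) := by positivity
  rw [eq_div_iff (by positivity), div_mul_eq_mul_div, div_mul_eq_mul_div, div_eq_iff (by positivity)]
  linear_combination (c * (gaussMoment q ^ (1 / q) + 1) * √(C * V)) * hpow

/-- The choice of `η`: the third condition keeps the box of spatial size `ηR` in positive time, the
fourth makes the contribution of the far point at most the prescribed `c₀`. -/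
theorem exists_small_scale {e c₀ t₀ R A₁ A₂ : ℝ} (he : 0 < e) (hc₀ : 0 < c₀) (ht₀ : 0 < t₀) :
    ∃ η : ℝ, 0 < η ∧ η ≤ 1 / 4 ∧ (η * R) ^ 2 ≤ t₀ ∧
      A₁ * η ^ e + A₂ * (16 * η ^ 2) ≤ c₀ := by
  have l1 : Tendsto (fun η : ℝ => A₁ * η ^ e + A₂ * (16 * η ^ 2)) (𝓝[>] 0) (𝓝 0) := by
    have hc : Continuous fun η : ℝ => A₁ * η ^ e + A₂ * (16 * η ^ 2) := by
      have := Real.continuous_rpow_const he.le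
      fun_prop
    have h := hc.tendsto 0
    simp only [Real.zero_rpow he.ne', mul_zero, add_zero, ne_eq, OfNat.ofNat_ne_zero,
      not_false_eq_true, zero_pow] at h
    exact h.mono_left nhdsWithin_le_nhds
  have l2 : Tendsto (fun η : ℝ => (η * R) ^ 2) (𝓝[>] 0) (𝓝 0) := by
    have hc : Continuous fun η : ℝ => (η * R) ^ 2 := by fun_prop
    have h := hc.tendsto 0
    simp only [zero_mul, ne_eq, OfNat.ofNat_ne_zero, not_false_eq_true, zero_pow] at h
    exact h.mono_left nhdsWithin_le_nhds
  have l3 : ∀ᶠ η : ℝ in 𝓝[>] 0, η < 1 / 4 :=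
    nhdsWithin_le_nhds (Iio_mem_nhds (by norm_num))
  obtain ⟨η, h1, h2, h3, h4⟩ := ((l1.eventually_lt_const hc₀).and
    ((l2.eventually_lt_const ht₀).and (l3.and self_mem_nhdsWithin))).exists
  exact ⟨η, h4, h3.le, h2.le, h1.le⟩

end Increments

end

end StochHeat

/-! ### The lower bound for the increments. -/

theorem proposition2p1 (k : ℕ) (β : ℝ) (hβ0 : 0 < β) (hβ : β < min 2 (k : ℝ))
    (p : ℝ) (hp : 1 < p) (t₀ : ℝ) (ht₀ : 0 < t₀)
    (K : Set (StochHeat.Eucl k)) (hK : IsCompact K) :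
    ∃ c : ℝ, 0 < c ∧
      ∀ (T : ℝ), t₀ < T →
      ∀ (d : ℕ) (Ω : Type*) [MeasurableSpace Ω] (P : Measure Ω) [IsProbabilityMeasure P]
        (F : Fin d → StochHeat.SpaceTimeTest k → Ω → ℝ)
        (M : Fin d → ℝ → Set (StochHeat.Eucl k) → Ω → ℝ)
        (v : ℝ → StochHeat.Eucl k → Ω → StochHeat.Eucl d),
        StochHeat.IsRieszNoise P β F →
        StochHeat.IsMartingaleMeasureOf P β F M →
        StochHeat.IsMildSolution P β M (fun _ => 1) (fun _ => 0) v →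
        ∀ (s t : ℝ), t₀ ≤ s → s ≤ t → t ≤ T → ∀ x ∈ K, ∀ y ∈ K, ∀ i : Fin d,
          c * (|t - s| ^ ((2 - β) / 4 * p) + ‖x - y‖ ^ ((2 - β) / 2 * p)) ≤
            ∫ ω, |v t x ω i - v s y ω i| ^ p ∂P := by
  have hβ2 : β < 2 := hβ.trans_le (min_le_left _ _)
  have hβk : β < k := hβ.trans_le (min_le_right _ _)
  have hk : 0 < k := by
    have : (0 : ℝ) < k := hβ0.trans hβk
    exact_mod_cast this
  obtain ⟨C, hC0, hC⟩ := StochHeat.exists_lintegral_ball_rpow_le hβ0 hβk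
  have hpq : p.HolderConjugate (Real.conjExponent p) := Real.HolderConjugate.conjExponent hp
  set q := Real.conjExponent p
  set V := volume.real (Metric.ball (0 : StochHeat.Eucl k) 1)
  have hV0 : 0 < V :=
    ENNReal.toReal_pos (Metric.measure_ball_pos _ _ one_pos).ne' measure_ball_lt_top.ne
  have hH := StochHeat.heatConst_pos k β
  -- The point `y` may use up at most half of `heatConst`; the other half survives in `κ`.
  obtain ⟨η, hη, hη4, hηt, hηc⟩ := StochHeat.exists_small_scale (R := Metric.diam K)
    (A₁ := V * 4 ^ β) (A₂ := C * 2 ^ ((k : ℝ) / 2)) hβ0 (half_pos hH) ht₀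
  have hm := StochHeat.gaussMoment_nonneg q
  set κ := StochHeat.heatConst k β / 2 /
    ((StochHeat.gaussMoment q ^ (1 / q) + 1) * √(C * V)) with hκ
  have hκ0 : 0 < κ := by positivity
  have hp0 : 0 < p := by linarith
  have hγ : 0 < (2 - β) / 2 := by linarith
  -- The factor `1/2` averages the time and space bounds; the power of `η` converts `η‖x-y‖` into
  -- `‖x-y‖`, and being at most `1` it does no harm in the time bound.
  refine ⟨κ ^ p * η ^ ((2 - β) / 2 * p) / 2, by positivity, ?_⟩
  intro T _ d Ω _ P _ F M v hF hM hv s t hs hst _ x hx y hy i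
  set N := ∫ ω, |v t x ω i - v s y ω i| ^ p ∂P with hN
  have hN0 : 0 ≤ N := integral_nonneg fun _ => by positivity
  have hs0 : 0 ≤ s := ht₀.le.trans hs
  have ht0 : 0 ≤ t := hs0.trans hst
  have hscale : ∀ {ρ : ℝ}, 0 < ρ →
      (κ * ρ ^ ((2 - β) / 2)) ^ p = κ ^ p * ρ ^ ((2 - β) / 2 * p) := fun {ρ} hρ => by
    rw [Real.mul_rpow hκ0.le (by positivity), ← Real.rpow_mul hρ.le]
  have htime : κ ^ p * (t - s) ^ ((2 - β) / 4 * p) ≤ N := by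
    rcases hst.eq_or_lt with rfl | hlt
    · rw [sub_self, Real.zero_rpow (by nlinarith), mul_zero]
      exact hN0
    have hρ : 0 < √(t - s) := Real.sqrt_pos.2 (sub_pos.2 hlt)
    have hρ2 : √(t - s) ^ 2 = t - s := Real.sq_sqrt (sub_pos.2 hlt).le
    have hi := (hv.integral_mul_increment hβ0 hβk hF hM ht0 x i hs0 hlt
      (measurableSet_ball (x := x) (ε := √(t - s))) Metric.isBounded_ball).2
    have hlow := StochHeat.le_rieszForm_heatShift hk hβ0 hs0 hlt le_rfl hρ (by linarith) x hi
    have h := hv.le_moment_of_le_pairing hβ0 hβk hC0 hC hF hM hpq hs0 ht0 x y i hs0 hρ hρ2.symm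
      (half_pos hH) (by
        rw [StochHeat.rieszForm_box_right_eq_zero le_rfl, sub_zero]
        refine le_trans ?_ hlow
        have := sub_pos.2 hlt
        gcongr
        linarith)
    rw [hscale hρ, Real.sqrt_eq_rpow, ← Real.rpow_mul (sub_pos.2 hlt).le] at h
    convert h using 3
    ring
  have hspace : κ ^ p * (η * ‖x - y‖) ^ ((2 - β) / 2 * p) ≤ N := by
    rcases eq_or_ne x y with rfl | hxy
    · rw [sub_self, norm_zero, mul_zero, Real.zero_rpow (by positivity), mul_zero]
      exact hN0
    have hδ : 0 < ‖x - y‖ := norm_pos_iff.2 (sub_ne_zero.2 hxy)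
    have hρ : 0 < η * ‖x - y‖ := by positivity
    -- When the time gap exceeds `ρ²`, the time bound dominates. Otherwise, with `a = s - ρ²`, one
    -- has `t - a ≤ 2ρ²`, exactly the range allowed in the lower estimate at `(t, x)`.
    rcases le_total ((η * ‖x - y‖) ^ 2) (t - s) with hle | hle
    · refine le_trans ?_ htime
      have : (η * ‖x - y‖) ^ ((2 - β) / 2 * p) = ((η * ‖x - y‖) ^ 2) ^ ((2 - β) / 4 * p) := by
        rw [← Real.rpow_natCast, ← Real.rpow_mul hρ.le]
        congr 1
        push_cast
        ring
      rw [this]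
      have : 0 ≤ (2 - β) / 4 * p := by nlinarith
      gcongr
    · have hρt : (η * ‖x - y‖) ^ 2 ≤ t₀ := by
        refine le_trans ?_ hηt
        gcongr
        rw [← dist_eq_norm]
        exact Metric.dist_le_diam_of_mem hK.isBounded hx hy
      have ha : 0 ≤ s - (η * ‖x - y‖) ^ 2 := by linarith
      have hlt : s - (η * ‖x - y‖) ^ 2 < s := by
        have : 0 < (η * ‖x - y‖) ^ 2 := by positivity
        linarith
      have hi := fun t (ht : 0 ≤ t) (w : StochHeat.Eucl k) =>
        (hv.integral_mul_increment hβ0 hβk hF hM ht w i ha hlt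
        (measurableSet_ball (x := x) (ε := η * ‖x - y‖)) Metric.isBounded_ball).2
      have hlow := StochHeat.le_rieszForm_heatShift hk hβ0 ha hlt hst hρ (by linarith) x
        (hi t ht0 x)
      have hup := StochHeat.rieszForm_heatShift_le hC0 hC hβ0 hlt hη hη4 hxy rfl (by linarith)
        (hi s hs0 y)
      have h := hv.le_moment_of_le_pairing hβ0 hβk hC0 hC hF hM hpq hs0 ht0 x y i ha hρ
        (sub_sub_cancel _ _) (half_pos hH) (by
          refine le_trans ?_ (sub_le_sub hlow hup)
          have hW : 0 ≤ (η * ‖x - y‖) ^ ((k : ℝ) - β) * (s - (s - (η * ‖x - y‖) ^ 2)) :=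
            mul_nonneg (by positivity) (sub_pos.2 hlt).le
          have := mul_le_mul_of_nonneg_right hηc hW
          linarith)
      rwa [hscale hρ] at h
  have hη1 : η ^ ((2 - β) / 2 * p) ≤ 1 :=
    Real.rpow_le_one hη.le (by linarith) (by positivity)
  rw [Real.mul_rpow hη.le (norm_nonneg _)] at hspace
  rw [abs_of_nonneg (sub_nonneg.2 hst)]
  have h1 : κ ^ p * η ^ ((2 - β) / 2 * p) * (t - s) ^ ((2 - β) / 4 * p) ≤ N := by
    refine le_trans ?_ htime
    have := Real.rpow_nonneg (sub_nonneg.2 hst) ((2 - β) / 4 * p)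
    gcongr
    exact mul_le_of_le_one_right (by positivity) hη1
  linarith
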